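/- **Setting.** Let $(\Omega,\mathcal F,\mathbb P)$ be a probability space and $\sigma\colon\Omega\to\Omega$ an invertible (bimeasurable) ergodic measure-preserving transformation. Let $X$ be a compact metric space with its Borel $\sigma$-algebra $\mathcal G$, and let $\mathcal X\subset\Omega\times X$ be an $\mathcal F\otimes\mathcal G$-measurable set with compact fibers $X_\omega=\{x:(\omega,x)\in\mathcal X\}$. For each $\omega$ let $m_\omega$ be a Borel probability measure on $X_\omega$ such that $\omega\mapsto\int_{X_\omega}g(\omega,x)\,dm_\omega(x)$ is measurable for every measurable $g\colon\mathcal X\to\mathbb R$, and let $T_\omega\colon X_\omega\to X_{\sigma\omega}$ be maps such that $(\omega,x)\mapsto T_\omega(x)$ is measurable on $\mathcal X$ and $(T_\omega)_*m_\omega\ll m_{\sigma\omega}$. Let $L_\omega\colon L^1(m_\omega)\to L^1(m_{\sigma\omega})$ (complex $L^1$ spaces) be the transfer operator, characterized by $\int (L_\omega\varphi)\psi\,dm_{\sigma\omega}=\int\varphi\,(\psi\circ T_\omega)\,dm_\omega$ for $\psi\in L^\infty(m_{\sigma\omega})$, and $L^{(n)}_\omega=L_{\sigma^{n-1}\omega}\circ\dots\circ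 L_\omega$. Assume that for every measurable $g\colon\mathcal X\to\mathbb R$ with $g(\omega,\cdot)\in L^1(m_\omega)$ for a.e. $\omega$, the family $L_\omega(g(\omega,\cdot))$ has a jointly measurable version. Each fiber carries a variation $\mathrm{var}_\omega\colon L^1(m_\omega)\to[0,\infty]$ such that, for all $g,h,f\in L^1(m_\omega)$ and $t\in\mathbb C$: (V1) $\mathrm{var}(th)=|t|\,\mathrm{var}(h)$; (V2) $\mathrm{var}(g+h)\le\mathrm{var}(g)+\mathrm{var}(h)$; (V3) $\|h\|_{L^\infty}\le C_{\mathrm{var}}(\|h\|_{L^1}+\mathrm{var}(h))$ with $C_{\mathrm{var}}$ independent of $\omega$; (V4) for every $R\geq 0$, $\{h:\|h\|_{L^1}+\mathrm{var}(h)\le R\}$ is compact in $L^1(m_\omega)$; (V5) $\mathrm{var}(1)<\infty$; (V6) $\{h\ge0:\|h\|_{L^1}=1,\ \mathrm{var}(h)<\infty\}$ is $L^1$-dense in $\{h\ge0:\|h\|_{L^1}=1\}$; (V7) $\mathrm{var}(1/f)\le\mathrm{var}(f)/(\operatorname{ess\,inf}f)^2$ if $f$ is real with $\operatorname{ess\,inf}f>0$;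 (V8) $\mathrm{var}(fg)\le\|f\|_{L^\infty}\mathrm{var}(g)+\|g\|_{L^\infty}\mathrm{var}(f)$; (V9) $\mathrm{var}(h\circ f)\le\|h'\|_{L^\infty}\mathrm{var}(f)$ for $M>0$, measurable $f\colon X_\omega\to[-M,M]$ and $h\colon[-M,M]\to\mathbb C$ of class $C^1$. Let $\mathcal B_\omega=\{\varphi\in L^1(m_\omega):\mathrm{var}_\omega(\varphi)<\infty\}$ with norm $\|\varphi\|_{\mathcal B_\omega}=\|\varphi\|_{L^1(m_\omega)}+\mathrm{var}_\omega(\varphi)$, and let $\mathcal B_\omega^*$ be its dual. The family $(L_\omega)$ is *admissible* if: (a) there is $K>0$ with $\|L_\omega\varphi\|_{\mathcal B_{\sigma\omega}}\le K\|\varphi\|_{\mathcal B_\omega}$ for a.e. $\omega$ and all $\varphi\in\mathcal B_\omega$; (b) there are $D,\kappa>0$ with $\|L^{(n)}_\omega\varphi\|_{\mathcal B_{\sigma^n\omega}}\le De^{-\kappa n}\|\varphi\|_{\mathcal B_\omega}$ for a.e. $\omega$, all $n$ and all $\varphi\in\mathcal B_\omega$ with $\int\varphi\,dm_\omega=0$;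 (c) for every $a>0$ there are $c>0$ and $n_0\in\mathbb N$ such that $\operatorname{ess\,inf}L^{(n)}_\omega\varphi\ge c\|\varphi\|_{L^1(m_\omega)}$ for a.e. $\omega$, all $n\ge n_0$ and all $\varphi\in\mathcal B_\omega$ with $\varphi\ge0$ and $\mathrm{var}_\omega(\varphi)\le a\int\varphi\,dm_\omega$. **Theorem.** Let $(L_\omega)$ be admissible and let $F\colon\mathcal X\to\mathbb R$ be measurable with $F(\omega,\cdot)\in\mathcal B_\omega$ for all $\omega$ and $\operatorname{ess\,sup}_\omega\|F(\omega,\cdot)\|_{\mathcal B_\omega}<\infty$. There is an essentially unique measurable $v\colon\mathcal X\to[0,\infty)$, $v_\omega=v(\omega,\cdot)$, with $\int v_\omega\,dm_\omega=1$ and $L_\omega v_\omega=v_{\sigma\omega}$ for a.e. $\omega$. For a.e. $\omega$ and all $\theta\in\mathbb C$, $L^\theta_\omega\varphi:=L_\omega(e^{\theta F(\omega,\cdot)}\varphi)$ defines a bounded operator $\mathcal B_\omega\to\mathcal B_{\sigma\omega}$; put $L^{\theta,(n)}_\omega=L^\theta_{\sigma^{n-1}\omega}\circ\dots\circ L^\theta_\omega$.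 There exist an open neighborhood $U$ of $0$ in $\mathbb C$ and, for each $\theta\in U$, a family $(\lambda_\omega^\theta,v_\omega^\theta,\phi_\omega^\theta)\in\mathbb C\times\mathcal B_\omega\times\mathcal B_\omega^*$, $\omega\in\Omega$, such that: 1. for a.e. $\omega$ and every $\theta\in U$: $L^\theta_\omega v^\theta_\omega=\lambda^\theta_\omega v^\theta_{\sigma\omega}$, $(L^\theta_\omega)^*\phi^\theta_{\sigma\omega}=\lambda^\theta_\omega\phi^\theta_\omega$ and $\phi^\theta_\omega(v^\theta_\omega)=1$; 2. for a.e. $\omega$: $\lambda^0_\omega=1$, $v^0_\omega=v_\omega$ and $\phi^0_\omega(\varphi)=\int\varphi\,dm_\omega$ for all $\varphi\in\mathcal B_\omega$; 3. for a.e. $\omega$ the maps $\theta\mapsto\lambda^\theta_\omega\in\mathbb C$, $\theta\mapsto v^\theta_\omega\in\mathcal B_\omega$, $\theta\mapsto\phi^\theta_\omega\in\mathcal B^*_\omega$ are analytic on $U$; 4. for each $\theta\in U$: $\omega\mapsto\lambda^\theta_\omega$ is measurable; $(\omega,x)\mapsto v^\theta_\omega(x)$ is measurable on $\mathcal X$ (for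 suitable representatives of the classes $v_\omega^\theta$); and $\omega\mapsto\phi^\theta_\omega(g(\omega,\cdot))$ is measurable for every measurable $g\colon\mathcal X\to\mathbb C$ with $g(\omega,\cdot)\in\mathcal B_\omega$ for all $\omega$; 5. there is $C>0$ with $\max\{|\lambda^\theta_\omega|,\|v^\theta_\omega\|_{\mathcal B_\omega},\|\phi^\theta_\omega\|_{\mathcal B^*_\omega}\}\le C$ for a.e. $\omega$ and every $\theta\in U$; 6. there are $c>0$ and $r\in(0,1)$ such that for a.e. $\omega$, all $n\in\mathbb N$, $\varphi\in\mathcal B_\omega$ and $\theta\in U$, $$\Big\|L^{\theta,(n)}_\omega\varphi-\Big(\prod_{i=0}^{n-1}\lambda^\theta_{\sigma^i\omega}\Big)\phi^\theta_\omega(\varphi)\,v^\theta_{\sigma^n\omega}\Big\|_{\mathcal B_{\sigma^n\omega}}\le c\,r^n\|\varphi\|_{\mathcal B_\omega}.$$ -/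

import Mathlib

open MeasureTheory Filter Topology
open scoped ENNReal NNReal

noncomputable section

/-- The transfer operator of a map `T : Y → Z` with respect to reference measures `μ` on `Y` and
`ν` on `Z`: the integrable function `f` is sent to the Radon-Nikodym density with respect to `ν` of
the push-forward under `T` of the complex measure `f dμ`. When `T` is measurable and
`T_* μ ≪ ν`, this is the unique `g ∈ L¹(ν)` with `∫ g ψ dν = ∫ f (ψ ∘ T) dμ` for `ψ ∈ L^∞(ν)`. -/
def transferL1 {Y Z : Type*} [MeasurableSpace Y] [MeasurableSpace Z]
    (T : Y → Z) (μ : Measure Y) (ν : Measure Z) (f : Y → ℂ) : Lp ℂ 1 ν :=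
  (ComplexMeasure.integrable_rnDeriv (VectorMeasure.map (μ.withDensityᵥ f) T) ν).toL1 _

/-- `φ ∈ L¹` takes real non-negative values. -/
def NonnegL1 {Y : Type*} [MeasurableSpace Y] {μ : Measure Y} (φ : Lp ℂ 1 μ) : Prop :=
  ∀ᵐ x ∂μ, (φ x).im = 0 ∧ 0 ≤ (φ x).re

/-- A notion of variation on the (complex) space `L¹(Y, μ)`: a map `var : L¹ → [0, ∞]` with
properties (V1)-(V9), where `C` is the constant in (V3). -/
structure Variation {Y : Type*} [MeasurableSpace Y] (μ : Measure Y) (C : ℝ≥0) where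
  var : Lp ℂ 1 μ → ℝ≥0∞
  var_smul : ∀ (t : ℂ) (h : Lp ℂ 1 μ), var (t • h) = ‖t‖ₑ * var h
  var_add : ∀ g h : Lp ℂ 1 μ, var (g + h) ≤ var g + var h
  eLpNorm_top_le : ∀ h : Lp ℂ 1 μ, eLpNorm h ∞ μ ≤ C * (‖h‖ₑ + var h)
  isCompact_ball : ∀ R : ℝ≥0, IsCompact {h : Lp ℂ 1 μ | ‖h‖ₑ + var h ≤ R}
  var_one : ∀ h : Lp ℂ 1 μ, h =ᵐ[μ] (fun _ => (1 : ℂ)) → var h < ∞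
  dense : {h : Lp ℂ 1 μ | NonnegL1 h ∧ ‖h‖ = 1} ⊆
    closure {h : Lp ℂ 1 μ | NonnegL1 h ∧ ‖h‖ = 1 ∧ var h < ∞}
  /-- if `ess inf f ≥ δ > 0` then `var (1/f) ≤ var f / δ²` -/
  var_inv : ∀ (f g : Lp ℂ 1 μ) (δ : ℝ), 0 < δ →
    (∀ᵐ x ∂μ, (f x).im = 0 ∧ δ ≤ (f x).re) → (∀ᵐ x ∂μ, g x = (f x)⁻¹) →
    var g ≤ var f / ENNReal.ofReal (δ ^ 2)
  var_mul : ∀ f g k : Lp ℂ 1 μ, (∀ᵐ x ∂μ, k x = f x * g x) →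
    var k ≤ eLpNorm f ∞ μ * var g + eLpNorm g ∞ μ * var f
  /-- for `f` with values in `[-M, M]` and `h : [-M, M] → ℂ` of class `C¹` with `‖h'‖_∞ ≤ D`,
  `var (h ∘ f) ≤ D var f` -/
  var_comp : ∀ (M : ℝ) (h : ℝ → ℂ) (D : ℝ≥0) (f k : Lp ℂ 1 μ), 0 < M →
    ContDiffOn ℝ 1 h (Set.Icc (-M) M) →
    (∀ t ∈ Set.Icc (-M) M, ‖derivWithin h (Set.Icc (-M) M) t‖ ≤ D) →
    (∀ᵐ x ∂μ, (f x).im = 0 ∧ (f x).re ∈ Set.Icc (-M) M) →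
    (∀ᵐ x ∂μ, k x = h (f x).re) →
    var k ≤ D * var f

namespace Variation

variable {Y : Type*} [MeasurableSpace Y] {μ : Measure Y} {C : ℝ≥0}

/-- `‖φ‖_{L¹} + var φ ∈ [0, ∞]`. -/
def bnorm (V : Variation μ C) (φ : Lp ℂ 1 μ) : ℝ≥0∞ := ‖φ‖ₑ + V.var φ

/-- The functions of finite variation, as a subspace of `L¹`. -/
def submodule (V : Variation μ C) : Submodule ℂ (Lp ℂ 1 μ) where
  carrier := {φ | V.var φ < ∞}
  zero_mem' := by
    have h := V.var_smul 0 0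
    simp only [zero_smul, enorm_zero, zero_mul] at h
    simp [h]
  add_mem' := fun {a b} ha hb => (V.var_add a b).trans_lt (ENNReal.add_lt_top.2 ⟨ha, hb⟩)
  smul_mem' := fun c x hx => by
    simp only [Set.mem_ofPred_eq, V.var_smul] at hx ⊢
    exact ENNReal.mul_lt_top enorm_lt_top hx

/-- The space `𝓑 = {φ ∈ L¹ : var φ < ∞}`, normed by `‖φ‖_𝓑 = ‖φ‖_{L¹} + var φ`. It is a type of
its own since its norm is not the one of `L¹`. -/
def Space (V : Variation μ C) : Type _ := V.submodule

variable (V : Variation μ C)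

instance : AddCommGroup V.Space := inferInstanceAs (AddCommGroup V.submodule)

instance : Module ℂ V.Space := inferInstanceAs (Module ℂ V.submodule)

/-- The class in `L¹` of an element of `𝓑`. -/
def Space.val {V : Variation μ C} (φ : V.Space) : Lp ℂ 1 μ := Subtype.val (p := (· ∈ V.submodule)) φ

instance : Norm V.Space := ⟨fun φ => ‖φ.val‖ + (V.var φ.val).toReal⟩

theorem space_core : NormedSpace.Core ℂ V.Space where
  norm_nonneg φ := add_nonneg (norm_nonneg _) ENNReal.toReal_nonneg
  norm_smul c φ := by
    change ‖c • φ.val‖ + (V.var (c • φ.val)).toReal = ‖c‖ * (‖φ.val‖ + (V.var φ.val).toReal)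
    rw [V.var_smul, norm_smul, ENNReal.toReal_mul, toReal_enorm, mul_add]
  norm_triangle φ ψ := by
    change ‖φ.val + ψ.val‖ + (V.var (φ.val + ψ.val)).toReal ≤
      (‖φ.val‖ + (V.var φ.val).toReal) + (‖ψ.val‖ + (V.var ψ.val).toReal)
    have hφ : V.var φ.val < ∞ := Subtype.property (p := (· ∈ V.submodule)) φ
    have hψ : V.var ψ.val < ∞ := Subtype.property (p := (· ∈ V.submodule)) ψ
    have h1 := norm_add_le φ.val ψ.val
    have h2 := ENNReal.toReal_mono (ENNReal.add_lt_top.2 ⟨hφ, hψ⟩).ne (V.var_add φ.val ψ.val)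
    rw [ENNReal.toReal_add hφ.ne hψ.ne] at h2
    linarith
  norm_eq_zero_iff φ := by
    constructor
    · intro h
      change ‖φ.val‖ + (V.var φ.val).toReal = 0 at h
      have h1 : ‖φ.val‖ = 0 := by
        have := norm_nonneg φ.val
        have := ENNReal.toReal_nonneg (a := V.var φ.val)
        linarith
      exact Subtype.ext (norm_eq_zero.1 h1)
    · rintro rfl
      change ‖(0 : Lp ℂ 1 μ)‖ + (V.var (0 : Lp ℂ 1 μ)).toReal = 0
      have h := V.var_smul 0 0
      simp only [zero_smul, enorm_zero, zero_mul] at h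
      simp [h]

instance : NormedAddCommGroup V.Space := NormedAddCommGroup.ofCore V.space_core

instance : NormedSpace ℂ V.Space := NormedSpace.ofCore V.space_core

end Variation

/-- The fiber `X_ω = {x : (ω, x) ∈ 𝒳}`. -/
abbrev fiber {Ω X : Type*} (𝒳 : Set (Ω × X)) (ω : Ω) : Set X := {x | (ω, x) ∈ 𝒳}

/-- The section `g(ω, ·) : X_ω → E` of a map `g : 𝒳 → E`. -/
def sect {Ω X E : Type*} {𝒳 : Set (Ω × X)} (g : 𝒳 → E) (ω : Ω) : fiber 𝒳 ω → E :=
  fun x => g ⟨(ω, x.1), x.2⟩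

/-- The section `g(ω, ·)` of a real function on `𝒳`, as a complex-valued function. -/
def csect {Ω X : Type*} {𝒳 : Set (Ω × X)} (g : 𝒳 → ℝ) (ω : Ω) : fiber 𝒳 ω → ℂ :=
  fun x => ((sect g ω x : ℝ) : ℂ)

/-- A random dynamical system with random compact fibers, over an invertible ergodic base,
with fiberwise reference measures, transfer operators and fiberwise notions of variation. -/
structure RandomSystem (Ω X : Type*) [MeasurableSpace Ω] (ℙ : Measure Ω)
    [MetricSpace X] [MeasurableSpace X] where
  σ : Ω ≃ᵐ Ω
  ergodic : Ergodic σ ℙ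
  𝒳 : Set (Ω × X)
  measurableSet_𝒳 : MeasurableSet 𝒳
  isCompact_fiber : ∀ ω, IsCompact (fiber 𝒳 ω)
  m : ∀ ω, Measure (fiber 𝒳 ω)
  isProbabilityMeasure : ∀ ω, IsProbabilityMeasure (m ω)
  measurable_m : ∀ g : 𝒳 → ℝ, Measurable g → Measurable fun ω => ∫ x, sect g ω x ∂(m ω)
  T : ∀ ω, fiber 𝒳 ω → fiber 𝒳 (σ ω)
  measurable_T : Measurable fun p : 𝒳 => (T p.1.1 ⟨p.1.2, p.2⟩ : X)
  nonsingular : ∀ ω, (m ω).map (T ω) ≪ m (σ ω)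
  /-- the transfer operators depend measurably on `ω`: `(L_ω g(ω, ·))_ω` has a jointly measurable
  version -/
  measurable_transfer : ∀ g : 𝒳 → ℝ, Measurable g →
    (∀ᵐ ω ∂ℙ, Integrable (sect g ω) (m ω)) →
    ∃ G : 𝒳 → ℝ, Measurable G ∧ ∀ᵐ ω ∂ℙ,
      transferL1 (T ω) (m ω) (m (σ ω)) (csect g ω) =ᵐ[m (σ ω)] csect G (σ ω)
  Cvar : ℝ≥0
  V : ∀ ω, Variation (m ω) Cvar

namespace RandomSystem

variable {Ω X : Type*} [MeasurableSpace Ω] {ℙ : Measure Ω} [MetricSpace X] [MeasurableSpace X]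

/-- The space `𝓑_ω`. -/
abbrev B (S : RandomSystem Ω X ℙ) (ω : Ω) : Type _ := (S.V ω).Space

/-- The transfer operator `L_ω : L¹(m_ω) → L¹(m_{σω})` of `T_ω`. -/
def transfer (S : RandomSystem Ω X ℙ) (ω : Ω) (φ : Lp ℂ 1 (S.m ω)) : Lp ℂ 1 (S.m (S.σ ω)) :=
  transferL1 (S.T ω) (S.m ω) (S.m (S.σ ω)) φ

/-- `L_ω^{(n)} = L_{σ^{n-1}ω} ∘ ⋯ ∘ L_{σω} ∘ L_ω`. -/
def transferIter (S : RandomSystem Ω X ℙ) :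
    (n : ℕ) → (ω : Ω) → Lp ℂ 1 (S.m ω) → Lp ℂ 1 (S.m (S.σ^[n] ω))
  | 0, _, φ => φ
  | n + 1, ω, φ => transferIter S n (S.σ ω) (S.transfer ω φ)

/-- Admissibility of the family `(L_ω)` of transfer operators. -/
structure Admissible (S : RandomSystem Ω X ℙ) : Prop where
  bounded : ∃ K : ℝ, 0 < K ∧ ∀ᵐ ω ∂ℙ, ∀ φ : Lp ℂ 1 (S.m ω), (S.V ω).var φ < ∞ →
    (S.V (S.σ ω)).bnorm (S.transfer ω φ) ≤ ENNReal.ofReal K * (S.V ω).bnorm φ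
  decay : ∃ C κ : ℝ, 0 < C ∧ 0 < κ ∧ ∀ᵐ ω ∂ℙ, ∀ n : ℕ, ∀ φ : Lp ℂ 1 (S.m ω),
    (S.V ω).var φ < ∞ → ∫ x, φ x ∂(S.m ω) = 0 →
    (S.V (S.σ^[n] ω)).bnorm (S.transferIter n ω φ) ≤
      ENNReal.ofReal (C * Real.exp (-κ * n)) * (S.V ω).bnorm φ
  cone : ∀ a : ℝ, 0 < a → ∃ c : ℝ, 0 < c ∧ ∃ n₀ : ℕ, ∀ᵐ ω ∂ℙ, ∀ n ≥ n₀, ∀ φ : Lp ℂ 1 (S.m ω),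
    NonnegL1 φ → (S.V ω).var φ ≤ ENNReal.ofReal (a * ∫ x, (φ x).re ∂(S.m ω)) →
    ∀ᵐ y ∂(S.m (S.σ^[n] ω)), c * ‖φ‖ ≤ (S.transferIter n ω φ y).re

/-- `v : 𝒳 → [0, ∞)` is a measurable equivariant density: `∫ v_ω dm_ω = 1` and
`L_ω v_ω = v_{σω}` for almost every `ω`. -/
structure IsEquivariantDensity (S : RandomSystem Ω X ℙ) (v : S.𝒳 → ℝ) : Prop where
  measurable : Measurable v
  nonneg : ∀ p, 0 ≤ v p
  integral_eq_one : ∀ᵐ ω ∂ℙ, ∫ x, sect v ω x ∂(S.m ω) = 1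
  equivariant : ∀ᵐ ω ∂ℙ,
    transferL1 (S.T ω) (S.m ω) (S.m (S.σ ω)) (csect v ω) =ᵐ[S.m (S.σ ω)] csect v (S.σ ω)

/-- The bounded operator `A : 𝓑_ω → 𝓑_{σω}` is the twisted transfer operator
`L_ω^θ φ = L_ω (e^{θ F(ω, ·)} φ)`. -/
def IsTwisted (S : RandomSystem Ω X ℙ) (F : S.𝒳 → ℝ) (θ : ℂ) (ω : Ω)
    (A : S.B ω →L[ℂ] S.B (S.σ ω)) : Prop :=
  ∀ φ : S.B ω, (A φ).val = transferL1 (S.T ω) (S.m ω) (S.m (S.σ ω))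
    (fun x => Complex.exp (θ * csect F ω x) * φ.val x)

/-- The iterates `A_{σ^{n-1}ω} ∘ ⋯ ∘ A_{σω} ∘ A_ω` of a family of operators `𝓑_ω → 𝓑_{σω}`. -/
def iterOp (S : RandomSystem Ω X ℙ) (A : ∀ ω, S.B ω →L[ℂ] S.B (S.σ ω)) :
    (n : ℕ) → (ω : Ω) → S.B ω →L[ℂ] S.B (S.σ^[n] ω)
  | 0, ω => ContinuousLinearMap.id ℂ (S.B ω)
  | n + 1, ω => (iterOp S A n (S.σ ω)).comp (A ω)

/-- Measurability of a family `v_ω ∈ 𝓑_ω`: `(ω, x) ↦ v_ω(x)` is measurable on `𝒳`, for suitable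
representatives of the classes `v_ω`. -/
def MeasurableVec (S : RandomSystem Ω X ℙ) (v : ∀ ω, S.B ω) : Prop :=
  ∃ g : S.𝒳 → ℂ, Measurable g ∧ ∀ ω, (v ω).val =ᵐ[S.m ω] sect g ω

/-- Measurability of a family `φ_ω ∈ 𝓑_ω^*`: `ω ↦ φ_ω(g(ω, ·))` is measurable for each measurable
`g : 𝒳 → ℂ` with `g(ω, ·) ∈ 𝓑_ω` for all `ω`. -/
def MeasurableDual (S : RandomSystem Ω X ℙ) (φ : ∀ ω, S.B ω →L[ℂ] ℂ) : Prop :=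
  ∀ (g : S.𝒳 → ℂ) (γ : ∀ ω, S.B ω), Measurable g →
    (∀ ω, (γ ω).val =ᵐ[S.m ω] sect g ω) → Measurable fun ω => φ ω (γ ω)

end RandomSystem

end

/-! ### Transfer operators between `L¹` spaces. -/

noncomputable section

section TransferL1

variable {Y Z : Type*} [MeasurableSpace Y] [MeasurableSpace Z] {T : Y → Z} {μ : Measure Y}
  {ν : Measure Z}

/-! All fibers are treated at once. On the Banach space `Fam` of bounded measurable families `w =
(w_ω)`, `w_ω ∈ 𝓑_ω`, with the sup norm, the twisted operators act by `(L^θ w)_{σω} = L^θ_ω w_ω`. The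
equivariant eigenvalue problem becomes the single equation `L^θ w = (∫ L^θ w) w`, in which the
scalar is a function of the base point. A solution in this space is automatically measurable and
uniformly bounded, and analyticity in the sup norm gives one neighborhood of `θ = 0` for all `ω`.
The exceptional null sets are removed beforehand: everything vanishes off a `σ`-invariant measurable
set of full measure on which the bounds hold everywhere.

At `θ = 0` the iterates of the constant family `1` converge to the density `v`, because `L`
preserves integrals and contracts families of zero integral (`exists_invariant_family`). The
derivative of `w ↦ L w - (∫ L w) w` at `v` is `-(1 - N)` with `N w = L w - (∫ L w) v`. The range of
`N` consists of families of zero integral, on which `N = L`; so its powers decay geometrically and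
`1 - N` is invertible (`isUnit_one_sub`). The implicit function theorem yields an analytic branch
`u^θ` of eigenvectors (`exists_analytic_eigenvector`).

The eigenvalue is `λ^θ_ω = ∫ L^θ_ω u^θ_ω`, uniformly close to `1`, and `M = λ⁻¹ L^θ` maps `u_ω` to
`u_{σω}`. Its transversal part `Q h = M h - (∫ M h) u` has values of zero integral and is close to
`L` there, hence contracts exponentially (`norm_cocycleIter_le_of_perturbation`). Two consecutive
functionals `∫ ∘ M^n` differ by a small multiple of `Q^n` (`functional_succ_sub`), so they converge
geometrically to the dual eigenfunctional, uniformly in `θ` and `ω`; this gives its analyticity,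
bounds and measurability. The identity `M^n h = (∫ M^n h) u + Q^n (h - (∫ h) u)` is then the
spectral gap.

For uniqueness, a competing density `w` is only in `L¹`, where no decay is available. The distance
`‖w_ω - v_ω‖_{L¹}` does not increase along orbits, hence is almost surely invariant under the
measure-preserving `σ`. Approximating `w_ω` by densities in `𝓑_ω`, which are attracted to `v`, shows
that it is arbitrarily small (`ae_eq_of_isEquivariantDensity`). -/

/-- `T_* μ ≪ ν` makes the pushed-forward complex measure absolutely continuous, so its real and
imaginary parts are recovered from their densities. Linearity, positivity and preservation of
integrals are all derived from this identity. -/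
theorem setIntegral_transferL1 [SigmaFinite ν] (hT : Measurable T) (hac : μ.map T ≪ ν)
    {f : Y → ℂ} (hf : Integrable f μ) {s : Set Z} (hs : MeasurableSet s) :
    ∫ y in s, transferL1 T μ ν f y ∂ν = ∫ x in T ⁻¹' s, f x ∂μ := by
  set c : ComplexMeasure Z := VectorMeasure.map (μ.withDensityᵥ f) T with hc
  have hcapp : ∀ t, MeasurableSet t → c t = ∫ x in T ⁻¹' t, f x ∂μ := fun t ht => by
    rw [hc, VectorMeasure.map_apply _ hT ht, withDensityᵥ_apply hf (hT ht)]
  have hcac : c ≪ᵥ ν.toENNRealVectorMeasure := by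
    refine VectorMeasure.AbsolutelyContinuous.mk fun t ht h0 => ?_
    rw [Measure.toENNRealVectorMeasure_apply_measurable ht] at h0
    have h1 := hac h0
    rw [Measure.map_apply hT ht] at h1
    rw [hcapp t ht, Measure.restrict_eq_zero.2 h1, integral_zero_measure]
  obtain ⟨hre, him⟩ := (ComplexMeasure.absolutelyContinuous_ennreal_iff c _).1 hcac
  rw [SignedMeasure.absolutelyContinuous_iff_withDensityᵥ_rnDeriv_eq] at hre him
  have hint := ComplexMeasure.integrable_rnDeriv c ν
  rw [← hcapp s hs, transferL1]
  rw [setIntegral_congr_ae hs (g := c.rnDeriv ν)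
    ((Integrable.coeFn_toL1 hint).mono fun x hx _ => hx)]
  have h1 : (∫ x in s, (c.re.rnDeriv ν) x ∂ν) = (c s).re := by
    rw [← withDensityᵥ_apply (SignedMeasure.integrable_rnDeriv _ _) hs, hre]; rfl
  have h2 : (∫ x in s, (c.im.rnDeriv ν) x ∂ν) = (c s).im := by
    rw [← withDensityᵥ_apply (SignedMeasure.integrable_rnDeriv _ _) hs, him]; rfl
  apply Complex.ext
  · rw [← h1]; exact (integral_re hint.integrableOn).symm
  · rw [← h2]; exact (integral_im hint.integrableOn).symm

theorem transferL1_ae_eq [SigmaFinite ν] (hT : Measurable T) (hac : μ.map T ≪ ν)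
    {f : Y → ℂ} (hf : Integrable f μ) {g : Z → ℂ} (hg : Integrable g ν)
    (h : ∀ s, MeasurableSet s → ∫ y in s, g y ∂ν = ∫ x in T ⁻¹' s, f x ∂μ) :
    transferL1 T μ ν f =ᵐ[ν] g :=
  Integrable.ae_eq_of_forall_setIntegral_eq _ _ (L1.integrable_coeFn _) hg fun s hs _ => by
    rw [setIntegral_transferL1 hT hac hf hs, h s hs]

theorem transferL1_congr {f g : Y → ℂ} (h : f =ᵐ[μ] g) :
    transferL1 T μ ν f = transferL1 T μ ν g := by
  rw [transferL1, transferL1]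
  congr 3
  exact WithDensityᵥEq.congr_ae h

theorem transferL1_add [SigmaFinite ν] (hT : Measurable T) (hac : μ.map T ≪ ν)
    (f g : Lp ℂ 1 μ) : transferL1 T μ ν ⇑(f + g) = transferL1 T μ ν f + transferL1 T μ ν g := by
  rw [transferL1_congr (Lp.coeFn_add f g)]
  have hf := L1.integrable_coeFn f
  have hg := L1.integrable_coeFn g
  refine Lp.ext ((transferL1_ae_eq hT hac (hf.add hg) (L1.integrable_coeFn _) fun s hs => ?_))
  rw [integral_congr_ae (ae_restrict_of_ae (Lp.coeFn_add _ _))]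
  simp only [Pi.add_apply]
  rw [integral_add (L1.integrable_coeFn _).integrableOn (L1.integrable_coeFn _).integrableOn,
    integral_add hf.integrableOn hg.integrableOn, setIntegral_transferL1 hT hac hf hs,
    setIntegral_transferL1 hT hac hg hs]

theorem transferL1_smul [SigmaFinite ν] (hT : Measurable T) (hac : μ.map T ≪ ν)
    (c : ℂ) (f : Lp ℂ 1 μ) : transferL1 T μ ν ⇑(c • f) = c • transferL1 T μ ν f := by
  rw [transferL1_congr (Lp.coeFn_smul c f)]
  have hf := L1.integrable_coeFn f
  refine Lp.ext ((transferL1_ae_eq hT hac (hf.smul c) (L1.integrable_coeFn _) fun s hs => ?_))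
  rw [integral_congr_ae (ae_restrict_of_ae (Lp.coeFn_smul _ _))]
  simp only [Pi.smul_apply]
  rw [integral_smul, integral_smul, setIntegral_transferL1 hT hac hf hs]

theorem integral_transferL1 [SigmaFinite ν] (hT : Measurable T) (hac : μ.map T ≪ ν)
    {f : Y → ℂ} (hf : Integrable f μ) :
    ∫ y, transferL1 T μ ν f y ∂ν = ∫ x, f x ∂μ := by
  simpa using setIntegral_transferL1 hT hac hf MeasurableSet.univ

theorem transferL1_nonneg [SigmaFinite ν] (hT : Measurable T) (hac : μ.map T ≪ ν)
    {f : Y → ℂ} (hf : Integrable f μ) (h0 : ∀ᵐ x ∂μ, (f x).im = 0 ∧ 0 ≤ (f x).re) :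
    NonnegL1 (transferL1 T μ ν f) := by
  have hg := L1.integrable_coeFn (transferL1 T μ ν f)
  have him : (fun y => (transferL1 T μ ν f y).im) =ᵐ[ν] fun _ => (0 : ℝ) := by
    refine Integrable.ae_eq_of_forall_setIntegral_eq _ _ hg.im (integrable_zero _ _ _)
      fun s hs _ => ?_
    have h1 := congrArg Complex.im (setIntegral_transferL1 hT hac hf hs)
    have h2 : (∫ x in T ⁻¹' s, (f x).im ∂μ) = (∫ x in T ⁻¹' s, f x ∂μ).im :=
      integral_im hf.integrableOn
    have h3 : (∫ y in s, (transferL1 T μ ν f y).im ∂ν) = (∫ y in s, transferL1 T μ ν f y ∂ν).im :=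
      integral_im hg.integrableOn
    rw [h3, h1, ← h2]
    simpa using integral_eq_zero_of_ae (ae_restrict_of_ae (h0.mono fun x hx => hx.1))
  have hre : 0 ≤ᵐ[ν] fun y => (transferL1 T μ ν f y).re := by
    refine ae_nonneg_of_forall_setIntegral_nonneg hg.re fun s hs _ => ?_
    have h1 := congrArg Complex.re (setIntegral_transferL1 hT hac hf hs)
    have h2 : (∫ x in T ⁻¹' s, (f x).re ∂μ) = (∫ x in T ⁻¹' s, f x ∂μ).re :=
      integral_re hf.integrableOn
    have h3 : (∫ y in s, (transferL1 T μ ν f y).re ∂ν) = (∫ y in s, transferL1 T μ ν f y ∂ν).re :=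
      integral_re hg.integrableOn
    rw [h3, h1, ← h2]
    exact integral_nonneg_of_ae (ae_restrict_of_ae (h0.mono fun x hx => hx.2))
  filter_upwards [him, hre] with y h1 h2 using ⟨h1, h2⟩

theorem NonnegL1.norm_eq {φ : Lp ℂ 1 μ} (h : NonnegL1 φ) : (‖φ‖ : ℂ) = ∫ x, φ x ∂μ := by
  rw [L1.norm_eq_integral_norm, ← integral_complex_ofReal]
  refine integral_congr_ae (h.mono fun x hx => ?_)
  have : φ x = ((φ x).re : ℂ) := Complex.ext (by simp) (by simp [hx.1])
  dsimp only
  rw [this, Complex.norm_real, Real.norm_of_nonneg hx.2]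

/-- The transfer operator contracts the `L¹` norm of real functions, and preserves realness. -/
theorem norm_transferL1_le [SigmaFinite ν] (hT : Measurable T) (hac : μ.map T ≪ ν)
    {f : Lp ℂ 1 μ} (hf : ∀ᵐ x ∂μ, (f x).im = 0) :
    ‖transferL1 T μ ν f‖ ≤ ‖f‖ ∧ ∀ᵐ y ∂ν, (transferL1 T μ ν f y).im = 0 := by
  have hfi := L1.integrable_coeFn f
  have hpi : Integrable (fun x => ((max (f x).re 0 : ℝ) : ℂ)) μ := hfi.re.pos_part.ofReal
  have hni : Integrable (fun x => ((max (-(f x).re) 0 : ℝ) : ℂ)) μ := hfi.re.neg_part.ofReal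
  set p : Lp ℂ 1 μ := hpi.toL1 _
  set n : Lp ℂ 1 μ := hni.toL1 _
  have hp := hpi.coeFn_toL1
  have hn := hni.coeFn_toL1
  have hp0 : NonnegL1 p := hp.mono fun x hx => by rw [show p x = _ from hx]; simp
  have hn0 : NonnegL1 n := hn.mono fun x hx => by rw [show n x = _ from hx]; simp
  have hfpn : f = p + (-1 : ℂ) • n := by
    refine Lp.ext ?_
    filter_upwards [hf, hp, hn, Lp.coeFn_add p ((-1 : ℂ) • n), Lp.coeFn_smul (-1 : ℂ) n]
      with x h0 h1 h2 h3 h4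
    rw [h3, Pi.add_apply, h4, Pi.smul_apply, h1, h2]
    apply Complex.ext
    · simp only [Complex.add_re, Complex.ofReal_re, smul_eq_mul, neg_mul, one_mul, Complex.neg_re]
      rcases le_total (f x).re 0 with h | h <;> simp [h]
    · simp [h0]
  have hTp := transferL1_nonneg hT hac (L1.integrable_coeFn p) hp0
  have hTn := transferL1_nonneg hT hac (L1.integrable_coeFn n) hn0
  -- On non-negative functions the norm is the integral, which is preserved; the contraction follows
  -- by splitting `f` into its positive and negative parts, whose norms add up to `‖f‖`.
  have key : ∀ g : Lp ℂ 1 μ, NonnegL1 g → ‖transferL1 T μ ν g‖ = ‖g‖ := fun g hg => by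
    have h1 := (transferL1_nonneg hT hac (L1.integrable_coeFn g) hg).norm_eq
    rw [integral_transferL1 hT hac (L1.integrable_coeFn g), ← hg.norm_eq] at h1
    exact_mod_cast h1
  have hsum : ‖p‖ + ‖n‖ = ‖f‖ := by
    rw [L1.norm_eq_integral_norm, L1.norm_eq_integral_norm, L1.norm_eq_integral_norm,
      ← integral_add (L1.integrable_coeFn p).norm (L1.integrable_coeFn n).norm]
    refine integral_congr_ae ?_
    filter_upwards [hf, hp, hn] with x h0 h1 h2
    have : f x = ((f x).re : ℂ) := Complex.ext (by simp) (by simp [h0])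
    rw [h1, h2]
    conv_rhs => rw [this]
    rw [Complex.norm_real, Complex.norm_real, Complex.norm_real]
    rcases le_total (f x).re 0 with h | h <;> simp [h, abs_of_nonpos, abs_of_nonneg]
  have hTf : transferL1 T μ ν f = transferL1 T μ ν p + (-1 : ℂ) • transferL1 T μ ν n := by
    rw [hfpn, transferL1_add hT hac, transferL1_smul hT hac]
  refine ⟨?_, ?_⟩
  · rw [hTf]
    refine (norm_add_le _ _).trans ?_
    rw [norm_smul, norm_neg, norm_one, one_mul, key p hp0, key n hn0, hsum]
  · rw [hTf]
    filter_upwards [hTp, hTn, Lp.coeFn_add (transferL1 T μ ν p) ((-1 : ℂ) • transferL1 T μ ν n),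
      Lp.coeFn_smul (-1 : ℂ) (transferL1 T μ ν n)] with x h1 h2 h3 h4
    rw [h3, Pi.add_apply, h4]
    simp [h1.1, h2.1]

end TransferL1

end

/-! ### The Banach space `𝓑`: completeness, products, exponentials. -/

noncomputable section

namespace Variation

variable {Y : Type*} [MeasurableSpace Y] {μ : Measure Y} {C : ℝ≥0} {V : Variation μ C}

/-- The element of `𝓑` given by an `L¹` class of finite variation. -/
def Space.mk (φ : Lp ℂ 1 μ) (h : V.var φ < ∞) : V.Space := ⟨φ, h⟩

@[simp] theorem Space.val_mk (φ : Lp ℂ 1 μ) (h : V.var φ < ∞) : (Space.mk φ h).val = φ := rfl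

@[simp] theorem Space.val_add (φ ψ : V.Space) : (φ + ψ).val = φ.val + ψ.val := rfl

@[simp] theorem Space.val_sub (φ ψ : V.Space) : (φ - ψ).val = φ.val - ψ.val := rfl

@[simp] theorem Space.val_smul (c : ℂ) (φ : V.Space) : (c • φ).val = c • φ.val := rfl

@[simp] theorem Space.val_zero : (0 : V.Space).val = 0 := rfl

theorem Space.val_injective : Function.Injective (Space.val (V := V)) := Subtype.val_injective

theorem Space.var_lt (φ : V.Space) : V.var φ.val < ∞ :=
  Subtype.property (p := (· ∈ V.submodule)) φ

theorem Space.norm_def (φ : V.Space) : ‖φ‖ = ‖φ.val‖ + (V.var φ.val).toReal := rfl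

theorem Space.norm_val_le (φ : V.Space) : ‖φ.val‖ ≤ ‖φ‖ := by
  rw [Space.norm_def]; linarith [ENNReal.toReal_nonneg (a := V.var φ.val)]

theorem Space.ofReal_norm (φ : V.Space) : ENNReal.ofReal ‖φ‖ = V.bnorm φ.val := by
  rw [Space.norm_def, ENNReal.ofReal_add (norm_nonneg _) ENNReal.toReal_nonneg,
    ENNReal.ofReal_toReal φ.var_lt.ne, _root_.ofReal_norm, bnorm]

theorem Space.bnorm_lt (φ : V.Space) : V.bnorm φ.val < ∞ := by
  rw [← Space.ofReal_norm]; exact ENNReal.ofReal_lt_top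

theorem Space.norm_le_iff (φ : V.Space) {R : ℝ} (hR : 0 ≤ R) :
    ‖φ‖ ≤ R ↔ V.bnorm φ.val ≤ ENNReal.ofReal R := by
  rw [← Space.ofReal_norm, ENNReal.ofReal_le_ofReal_iff hR]

theorem isClosed_bnorm_le (V : Variation μ C) (R : ℝ) :
    IsClosed {h : Lp ℂ 1 μ | V.bnorm h ≤ ENNReal.ofReal R} :=
  (V.isCompact_ball R.toNNReal).isClosed

/-- The inclusion of `𝓑` into `L¹`. -/
def valCLM (V : Variation μ C) : V.Space →L[ℂ] Lp ℂ 1 μ :=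
  LinearMap.mkContinuous
    { toFun := Space.val, map_add' := fun _ _ => rfl, map_smul' := fun _ _ => rfl }
    1 fun φ => by rw [one_mul]; exact φ.norm_val_le

/-- By (V4) the balls of `𝓑` are closed in `L¹`, so the `L¹` limit of a `𝓑`-Cauchy sequence inherits
the Cauchy estimates. -/
instance : CompleteSpace V.Space := by
  refine Metric.complete_of_cauchySeq_tendsto fun u hu => ?_
  have hu1 : CauchySeq fun n => (u n).val := hu.map V.valCLM.uniformContinuous
  obtain ⟨h, hh⟩ := cauchySeq_tendsto_of_complete hu1
  have key : ∀ ε > 0, ∃ N, ∀ n ≥ N, V.bnorm ((u n).val - h) ≤ ENNReal.ofReal ε := fun ε hε => by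
    obtain ⟨N, hN⟩ := Metric.cauchySeq_iff.1 hu ε hε
    refine ⟨N, fun n hn => ?_⟩
    have ht : Tendsto (fun m => (u n).val - (u m).val) atTop (𝓝 ((u n).val - h)) :=
      tendsto_const_nhds.sub hh
    refine (V.isClosed_bnorm_le ε).mem_of_tendsto ht ?_
    filter_upwards [eventually_ge_atTop N] with m hm
    have := (hN n hn m hm).le
    rw [dist_eq_norm] at this
    exact (Space.norm_le_iff (u n - u m) hε.le).1 this
  have hfin : V.var h < ∞ := by
    obtain ⟨N, hN⟩ := key 1 one_pos
    have h1 : V.var ((u N).val - h) < ∞ :=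
      (le_add_self.trans (hN N le_rfl)).trans_lt ENNReal.ofReal_lt_top
    have h2 : h = (u N).val - (Space.mk _ h1 : V.Space).val := by simp
    rw [h2]
    exact (u N - Space.mk _ h1).var_lt
  refine ⟨Space.mk h hfin, Metric.tendsto_atTop.2 fun ε hε => ?_⟩
  obtain ⟨N, hN⟩ := key (ε / 2) (by positivity)
  refine ⟨N, fun n hn => ?_⟩
  rw [dist_eq_norm]
  refine lt_of_le_of_lt ((Space.norm_le_iff _ (by positivity)).2 ?_) (half_lt_self hε)
  exact hN n hn

theorem Space.eLpNorm_top_le_norm (φ : V.Space) :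
    eLpNorm φ.val ∞ μ ≤ ENNReal.ofReal (C * ‖φ‖) := by
  rw [ENNReal.ofReal_mul (by positivity), Space.ofReal_norm]
  exact (V.eLpNorm_top_le φ.val).trans_eq (by simp [bnorm])

theorem Space.ae_norm_le (φ : V.Space) : ∀ᵐ x ∂μ, ‖φ.val x‖ ≤ C * ‖φ‖ := by
  have h := φ.eLpNorm_top_le_norm
  rw [eLpNorm_exponent_top] at h
  filter_upwards [enorm_ae_le_eLpNormEssSup φ.val μ] with x hx
  have := hx.trans h
  rwa [← _root_.ofReal_norm, ENNReal.ofReal_le_ofReal_iff (by positivity)] at this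

theorem Space.integrable_mul (f g : V.Space) : Integrable (fun x => f.val x * g.val x) μ :=
  (L1.integrable_coeFn g.val).bdd_mul (L1.integrable_coeFn f.val).aestronglyMeasurable f.ae_norm_le

theorem Space.var_mul_lt (f g : V.Space) : V.var ((f.integrable_mul g).toL1 _) < ∞ := by
  refine (V.var_mul f.val g.val _ ?_).trans_lt ?_
  · exact (f.integrable_mul g).coeFn_toL1
  · exact ENNReal.add_lt_top.2
      ⟨ENNReal.mul_lt_top (f.eLpNorm_top_le_norm.trans_lt ENNReal.ofReal_lt_top) g.var_lt,
        ENNReal.mul_lt_top (g.eLpNorm_top_le_norm.trans_lt ENNReal.ofReal_lt_top) f.var_lt⟩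

/-- The pointwise product on `𝓑`. -/
def Space.mul (f g : V.Space) : V.Space := Space.mk ((f.integrable_mul g).toL1 _) (f.var_mul_lt g)

theorem Space.mul_ae_eq (f g : V.Space) : (f.mul g).val =ᵐ[μ] fun x => f.val x * g.val x :=
  (f.integrable_mul g).coeFn_toL1

/-- One `C` comes from the `L¹` part and one from each term of (V8), the sup norms being bounded by
(V3). The constant does not depend on the fiber. -/
theorem Space.norm_mul_le (f g : V.Space) : ‖f.mul g‖ ≤ 3 * C * ‖f‖ * ‖g‖ := by
  have h1 : ‖(f.mul g).val‖ ≤ C * ‖f‖ * ‖g‖ := by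
    have h0 : ‖(f.mul g).val‖ ≤ C * ‖f‖ * ‖g.val‖ := by
      rw [L1.norm_eq_integral_norm, L1.norm_eq_integral_norm, ← integral_const_mul]
      refine integral_mono_ae (L1.integrable_coeFn _).norm
        ((L1.integrable_coeFn _).norm.const_mul _) ?_
      filter_upwards [f.mul_ae_eq g, f.ae_norm_le] with x hx hx'
      rw [hx, _root_.norm_mul]
      gcongr
    exact h0.trans (by gcongr; exact g.norm_val_le)
  have hv : ∀ f : V.Space, V.var f.val ≤ ENNReal.ofReal ‖f‖ := fun f => by
    rw [Space.ofReal_norm]; exact le_add_self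
  have h2 : V.var (f.mul g).val ≤ ENNReal.ofReal (C * ‖f‖ * ‖g‖ + C * ‖g‖ * ‖f‖) := by
    rw [ENNReal.ofReal_add (by positivity) (by positivity),
      ENNReal.ofReal_mul (p := C * ‖f‖) (by positivity),
      ENNReal.ofReal_mul (p := C * ‖g‖) (by positivity)]
    refine (V.var_mul f.val g.val _ (f.mul_ae_eq g)).trans ?_
    gcongr
    · exact f.eLpNorm_top_le_norm
    · exact hv g
    · exact g.eLpNorm_top_le_norm
    · exact hv f
  have h3 := ENNReal.toReal_mono ENNReal.ofReal_ne_top h2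
  rw [ENNReal.toReal_ofReal (by positivity)] at h3
  rw [Space.norm_def]
  linarith

/-- Multiplication by `f` as a bounded operator on `𝓑`. -/
def mulCLM (f : V.Space) : V.Space →L[ℂ] V.Space :=
  LinearMap.mkContinuous
    { toFun := fun g => f.mul g
      map_add' := fun g h => Space.val_injective <| Lp.ext <| by
        filter_upwards [f.mul_ae_eq (g + h), f.mul_ae_eq g, f.mul_ae_eq h,
          Lp.coeFn_add g.val h.val, Lp.coeFn_add (f.mul g).val (f.mul h).val] with x h1 h2 h3 h4 h5
        rw [h1, Space.val_add, Space.val_add, h4, h5, Pi.add_apply, Pi.add_apply, h2, h3, mul_add]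
      map_smul' := fun c g => Space.val_injective <| Lp.ext <| by
        filter_upwards [f.mul_ae_eq (c • g), f.mul_ae_eq g,
          Lp.coeFn_smul c g.val, Lp.coeFn_smul c (f.mul g).val] with x h1 h2 h3 h4
        rw [h1, RingHom.id_apply, Space.val_smul, Space.val_smul, h3, h4, Pi.smul_apply,
          Pi.smul_apply, h2, smul_eq_mul, smul_eq_mul, mul_left_comm] }
    (3 * C * ‖f‖) fun g => f.norm_mul_le g

theorem mulCLM_ae_eq (f g : V.Space) : (mulCLM f g).val =ᵐ[μ] fun x => f.val x * g.val x :=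
  f.mul_ae_eq g

theorem norm_mulCLM_le (f : V.Space) : ‖mulCLM f‖ ≤ 3 * C * ‖f‖ :=
  LinearMap.mkContinuous_norm_le _ (by positivity) _

/-- Convergence in `𝓑` implies almost everywhere convergence. -/
theorem Space.ae_tendsto {u : ℕ → V.Space} {f : V.Space} (h : Tendsto u atTop (𝓝 f)) :
    ∀ᵐ x ∂μ, Tendsto (fun n => (u n).val x) atTop (𝓝 (f.val x)) := by
  have h1 : ∀ᵐ x ∂μ, ∀ n, ‖(u n).val x - f.val x‖ ≤ C * ‖u n - f‖ := by
    refine ae_all_iff.2 fun n => ?_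
    filter_upwards [(u n - f).ae_norm_le, Lp.coeFn_sub (u n).val f.val] with x hx hx'
    rw [Space.val_sub, hx', Pi.sub_apply] at hx
    exact hx
  filter_upwards [h1] with x hx
  rw [tendsto_iff_norm_sub_tendsto_zero]
  refine squeeze_zero (fun _ => norm_nonneg _) hx ?_
  simpa using (tendsto_iff_norm_sub_tendsto_zero.1 h).const_mul (C : ℝ)

/-- Multiplication by `exp (θ f)` is the exponential of the operator of multiplication by `θ f`. -/
theorem exp_mulCLM_ae_eq (f g : V.Space) (θ : ℂ) :
    (NormedSpace.exp (θ • mulCLM f) g).val =ᵐ[μ] fun x => Complex.exp (θ * f.val x) * g.val x := by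
  have hpow : ∀ n : ℕ, ∀ᵐ x ∂μ, ((mulCLM f ^ n) g).val x = f.val x ^ n * g.val x := fun n => by
    induction n with
    | zero => simp
    | succ n ih =>
      filter_upwards [ih, mulCLM_ae_eq f ((mulCLM f ^ n) g)] with x h1 h2
      rw [pow_succ' (f.val x), mul_assoc, ← h1, ← h2, pow_succ']
      rfl
  have hsum := ((ContinuousLinearMap.apply ℂ V.Space g).hasSum
    (NormedSpace.exp_series_hasSum_exp' (𝕂 := ℂ) (θ • mulCLM f))).tendsto_sum_nat
  have hpart : ∀ N : ℕ, ∀ᵐ x ∂μ, (∑ n ∈ Finset.range N, (ContinuousLinearMap.apply ℂ V.Space g)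
      ((n.factorial : ℂ)⁻¹ • (θ • mulCLM f) ^ n)).val x =
      ∑ n ∈ Finset.range N, ((n.factorial : ℂ)⁻¹ * (θ * f.val x) ^ n) * g.val x := fun N => by
    induction N with
    | zero =>
      simp only [Finset.range_zero, Finset.sum_empty, Space.val_zero]
      exact Lp.coeFn_zero _ _ _
    | succ N ih =>
      simp only [Finset.sum_range_succ]
      set a := ∑ n ∈ Finset.range N, (ContinuousLinearMap.apply ℂ V.Space g)
        ((n.factorial : ℂ)⁻¹ • (θ • mulCLM f) ^ n)
      have hb : (ContinuousLinearMap.apply ℂ V.Space g)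
          ((N.factorial : ℂ)⁻¹ • (θ • mulCLM f) ^ N) =
          ((N.factorial : ℂ)⁻¹ * θ ^ N) • (mulCLM f ^ N) g := by
        simp [smul_pow, smul_smul]
      rw [hb]
      filter_upwards [ih, hpow N, Lp.coeFn_add a.val
        (((N.factorial : ℂ)⁻¹ * θ ^ N) • ((mulCLM f ^ N) g).val),
        Lp.coeFn_smul ((N.factorial : ℂ)⁻¹ * θ ^ N) ((mulCLM f ^ N) g).val] with x h1 h2 h3 h4
      rw [Space.val_add, Space.val_smul, h3, Pi.add_apply, h1, h4, Pi.smul_apply, h2, smul_eq_mul]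
      ring
  -- The partial sums converge in `𝓑`, hence almost everywhere, so the limit is identified with the
  -- scalar exponential series at `x`.
  filter_upwards [Space.ae_tendsto hsum, ae_all_iff.2 hpart] with x h1 h2
  refine tendsto_nhds_unique h1 ?_
  simp only [h2, ← Finset.sum_mul]
  refine Tendsto.mul_const _ ?_
  have := (NormedSpace.exp_series_hasSum_exp' (𝕂 := ℂ) (θ * f.val x)).tendsto_sum_nat
  rw [← Complex.exp_eq_exp_ℂ] at this
  simpa using this

theorem exists_one [IsProbabilityMeasure μ] (V : Variation μ C) :
    ∃ e : V.Space, e.val =ᵐ[μ] (fun _ => (1 : ℂ)) ∧ ‖e‖ = 1 := by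
  have hi : Integrable (fun _ : Y => (1 : ℂ)) μ := integrable_const _
  -- (V9) with `f = 0`, `h = 1` constant and derivative bound `0` forces `var 1 = 0`. Thus `1` has
  -- norm `1` in every fiber, a uniform bound that finiteness of `var 1` alone would not give.
  have hv : V.var (hi.toL1 _) = 0 := by
    have := V.var_comp 1 (fun _ => 1) 0 0 (hi.toL1 _) one_pos contDiffOn_const
      (by simp) ?_ hi.coeFn_toL1
    · simpa using this
    · filter_upwards [Lp.coeFn_zero ℂ 1 μ] with x hx
      simp
  refine ⟨Space.mk (hi.toL1 _) (by simp [hv]), hi.coeFn_toL1, ?_⟩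
  rw [Space.norm_def, Space.val_mk, hv, L1.norm_eq_integral_norm,
    integral_congr_ae (hi.coeFn_toL1.mono fun x hx => by rw [hx])]
  simp

/-- The integral as a functional on `𝓑`. -/
def intCLM (V : Variation μ C) : V.Space →L[ℂ] ℂ :=
  LinearMap.mkContinuous
    { toFun := fun φ => ∫ x, φ.val x ∂μ
      map_add' := fun φ ψ => by
        rw [Space.val_add, integral_congr_ae (Lp.coeFn_add φ.val ψ.val)]
        exact integral_add (L1.integrable_coeFn _) (L1.integrable_coeFn _)
      map_smul' := fun c φ => by
        rw [Space.val_smul, integral_congr_ae (Lp.coeFn_smul c φ.val)]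
        exact integral_smul c _ }
    1 fun φ => by
      refine (norm_integral_le_integral_norm _).trans ?_
      rw [← L1.norm_eq_integral_norm, one_mul]
      exact φ.norm_val_le

theorem intCLM_apply (φ : V.Space) : V.intCLM φ = ∫ x, φ.val x ∂μ := rfl

theorem norm_intCLM_apply_le (φ : V.Space) : ‖V.intCLM φ‖ ≤ ‖φ‖ := by
  refine (V.intCLM.le_opNorm φ).trans ?_
  exact mul_le_of_le_one_left (norm_nonneg _) (LinearMap.mkContinuous_norm_le _ zero_le_one _)

end Variation

end

/-! ### Joint measurability of families of vectors. -/

noncomputable section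

theorem measurable_sect {Ω X E : Type*} [MeasurableSpace Ω] [MeasurableSpace X] [MeasurableSpace E]
    {𝒳 : Set (Ω × X)} {g : 𝒳 → E} (hg : Measurable g) (ω : Ω) : Measurable (sect g ω) :=
  hg.comp ((measurable_const.prodMk measurable_subtype_coe).subtype_mk)

namespace RandomSystem

variable {Ω X : Type*} [MeasurableSpace Ω] {ℙ : Measure Ω} [MetricSpace X] [MeasurableSpace X]
  (S : RandomSystem Ω X ℙ)

instance (ω : Ω) : IsProbabilityMeasure (S.m ω) := S.isProbabilityMeasure ω

theorem measurable_fiberMap (ω : Ω) : Measurable (S.T ω) :=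
  Measurable.subtype_mk (f := fun x => (S.T ω x : X))
    (measurable_sect S.measurable_T ω)

theorem measurable_integral_sect {g : S.𝒳 → ℂ} (hg : Measurable g)
    (hi : ∀ ω, Integrable (sect g ω) (S.m ω)) :
    Measurable fun ω => ∫ x, sect g ω x ∂(S.m ω) := by
  have h1 := S.measurable_m (fun p => (g p).re) (Complex.measurable_re.comp hg)
  have h2 := S.measurable_m (fun p => (g p).im) (Complex.measurable_im.comp hg)
  have h3 : (fun ω => ∫ x, sect g ω x ∂(S.m ω)) = fun ω =>
      ((∫ x, sect (fun p => (g p).re) ω x ∂(S.m ω) : ℝ) : ℂ) +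
        ((∫ x, sect (fun p => (g p).im) ω x ∂(S.m ω) : ℝ) : ℂ) * Complex.I := by
    funext ω
    exact (integral_re_add_im (hi ω)).symm
  rw [h3]
  exact (Complex.measurable_ofReal.comp h1).add
    ((Complex.measurable_ofReal.comp h2).mul_const _)

theorem measurable_setLIntegral_sect {g : S.𝒳 → ℝ} (hg : Measurable g) (h0 : ∀ p, 0 ≤ g p)
    (hi : ∀ ω, Integrable (sect g ω) (S.m ω)) {A : Set S.𝒳} (hA : MeasurableSet A) :
    Measurable fun ω => ∫⁻ x in {x | sect id ω x ∈ A}, ENNReal.ofReal (sect g ω x) ∂(S.m ω) := by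
  have h1 := S.measurable_m (A.indicator g) (hg.indicator hA)
  have h2 : (fun ω => ∫⁻ x in {x | sect id ω x ∈ A}, ENNReal.ofReal (sect g ω x) ∂(S.m ω)) =
      fun ω => ENNReal.ofReal (∫ x, sect (A.indicator g) ω x ∂(S.m ω)) := by
    funext ω
    have hAω : MeasurableSet {x | sect id ω x ∈ A} := measurable_sect measurable_id ω hA
    rw [← ofReal_integral_eq_lintegral_ofReal (hi ω).integrableOn (ae_of_all _ fun x => h0 _),
      ← integral_indicator hAω]
    rfl
  rw [h2]
  exact h1.ennreal_ofReal

/-- The measures `(T_ω)_* (g_ω m_ω)` and `m_{σω}` form kernels from `Ω` to `X`, and the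
Radon-Nikodym derivative of kernels is jointly measurable. This yields a version valid for every
`ω`, so no null set has to be discarded when families are transported. -/
theorem exists_measurable_transfer_nonneg [CompactSpace X] [BorelSpace X]
    {g : S.𝒳 → ℝ} (hg : Measurable g) (h0 : ∀ p, 0 ≤ g p)
    (hi : ∀ ω, Integrable (sect g ω) (S.m ω)) :
    ∃ G : S.𝒳 → ℝ, Measurable G ∧ ∀ ω, Integrable (sect G (S.σ ω)) (S.m (S.σ ω)) ∧
      ∀ s, MeasurableSet s →
        ∫ y in s, sect G (S.σ ω) y ∂(S.m (S.σ ω)) = ∫ x in S.T ω ⁻¹' s, sect g ω x ∂(S.m ω) := by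
  -- Dividing by `a` bounds the masses by `1`, as a finite kernel requires; the summand `1` keeps
  -- `a` away from zero.
  set a : Ω → ℝ := fun ω => 1 + ∫ x, sect g ω x ∂(S.m ω) with ha
  have ham : Measurable a := measurable_const.add (S.measurable_m g hg)
  have ha1 : ∀ ω, 1 ≤ a ω := fun ω => le_add_of_nonneg_right (integral_nonneg fun x => h0 _)
  set g₁ : S.𝒳 → ℝ := fun p => (a p.1.1)⁻¹ * g p with hg₁
  have hg₁m : Measurable g₁ := (ham.comp (measurable_fst.comp measurable_subtype_coe)).inv.mul hg
  have hg₁0 : ∀ p, 0 ≤ g₁ p := fun p =>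
    mul_nonneg (inv_nonneg.2 (zero_le_one.trans (ha1 _))) (h0 p)
  have hg₁i : ∀ ω, Integrable (sect g₁ ω) (S.m ω) := fun ω =>
    (hi ω).const_mul (a ω)⁻¹
  have hg₁le : ∀ ω, ∫ x, sect g₁ ω x ∂(S.m ω) ≤ 1 := fun ω => by
    have : ∫ x, sect g₁ ω x ∂(S.m ω) = (a ω)⁻¹ * ∫ x, sect g ω x ∂(S.m ω) :=
      integral_const_mul (a ω)⁻¹ (sect g ω)
    rw [this, inv_mul_le_iff₀ (zero_lt_one.trans_le (ha1 ω)), ha]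
    simp
  have hTm : ∀ ω, Measurable fun x => (S.T ω x : X) := fun ω =>
    measurable_subtype_coe.comp (S.measurable_fiberMap ω)
  -- The measures are pushed to `X`, since the fibers vary with `ω`.
  let κ : ProbabilityTheory.Kernel Ω X :=
    { toFun := fun ω => ((S.m ω).withDensity fun x => ENNReal.ofReal (sect g₁ ω x)).map
        fun x => (S.T ω x : X)
      measurable' := by
        refine Measure.measurable_of_measurable_coe _ fun s hs => ?_
        have := S.measurable_setLIntegral_sect hg₁m hg₁0 hg₁i (S.measurable_T hs)
        refine (congrArg Measurable (funext fun ω => ?_)).mp this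
        symm
        rw [Measure.map_apply (hTm ω) hs, withDensity_apply _ (hTm ω hs)]
        rfl }
  let η : ProbabilityTheory.Kernel Ω X :=
    { toFun := fun ω => (S.m (S.σ ω)).map Subtype.val
      measurable' := by
        refine Measure.measurable_of_measurable_coe _ fun s hs => ?_
        have hA : MeasurableSet {p : S.𝒳 | p.1.2 ∈ s} :=
          (measurable_snd.comp measurable_subtype_coe) hs
        have := (S.measurable_setLIntegral_sect (g := fun _ => 1) measurable_const
          (fun _ => zero_le_one) (fun ω => integrable_const _) hA).comp S.σ.measurable
        refine (congrArg Measurable (funext fun ω => ?_)).mp this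
        symm
        rw [Measure.map_apply measurable_subtype_coe hs]
        simp only [Function.comp_apply, sect, ENNReal.ofReal_one, lintegral_const,
          Measure.restrict_apply_univ, one_mul]
        rfl }
  have hκ : ∀ ω, κ ω = ((S.m ω).withDensity fun x => ENNReal.ofReal (sect g₁ ω x)).map
        fun x => (S.T ω x : X) := fun _ => rfl
  have hη : ∀ ω, η ω = (S.m (S.σ ω)).map Subtype.val := fun _ => rfl
  have : ProbabilityTheory.IsFiniteKernel κ := ⟨1, ENNReal.one_lt_top, fun ω => by
    rw [hκ, Measure.map_apply (hTm ω) MeasurableSet.univ, Set.preimage_univ,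
      withDensity_apply _ MeasurableSet.univ, Measure.restrict_univ,
      ← ofReal_integral_eq_lintegral_ofReal (hg₁i ω) (ae_of_all _ fun x => hg₁0 _)]
    exact ENNReal.ofReal_le_one.2 (hg₁le ω)⟩
  have : ProbabilityTheory.IsFiniteKernel η := ⟨1, ENNReal.one_lt_top, fun ω => by
    rw [hη, Measure.map_apply measurable_subtype_coe MeasurableSet.univ]
    exact prob_le_one⟩
  have hac : ∀ ω, κ ω ≪ η ω := fun ω => by
    refine Measure.AbsolutelyContinuous.mk fun s hs h => ?_
    rw [hη, Measure.map_apply measurable_subtype_coe hs] at h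
    have h2 := S.nonsingular ω h
    rw [Measure.map_apply (S.measurable_fiberMap ω) (measurable_subtype_coe hs)] at h2
    rw [hκ, Measure.map_apply (hTm ω) hs]
    exact withDensity_absolutelyContinuous _ _ h2
  set ρ := κ.rnDeriv η with hρ
  have hρm : Measurable fun p : Ω × X => ρ p.1 p.2 := ProbabilityTheory.Kernel.measurable_rnDeriv κ η
  have hρω : ∀ ω, Measurable (ρ ω) := fun ω => hρm.comp measurable_prodMk_left
  have hwd : ∀ ω, (η ω).withDensity (ρ ω) = κ ω := fun ω => by
    rw [withDensity_congr_ae ProbabilityTheory.Kernel.rnDeriv_eq_rnDeriv_measure,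
      Measure.withDensity_rnDeriv_eq _ _ (hac ω)]
  have hlin : ∀ ω (t : Set X), MeasurableSet t →
      ∫⁻ y in Subtype.val ⁻¹' t, ρ ω (y : X) ∂(S.m (S.σ ω)) = κ ω t := fun ω t ht => by
    rw [← hwd ω, withDensity_apply _ ht, hη, setLIntegral_map ht (hρω ω) measurable_subtype_coe]
  have hfin : ∀ ω (t : Set X), MeasurableSet t →
      ∫⁻ y in Subtype.val ⁻¹' t, ρ ω (y : X) ∂(S.m (S.σ ω)) ≠ ∞ := fun ω t ht => by
    rw [hlin ω t ht]; exact measure_ne_top _ _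
  have hρi : ∀ ω, Integrable (fun y : fiber S.𝒳 (S.σ ω) => (ρ ω (y : X)).toReal) (S.m (S.σ ω)) :=
      fun ω => by
    refine integrable_toReal_of_lintegral_ne_top
      ((hρω ω).comp measurable_subtype_coe).aemeasurable ?_
    simpa using hfin ω Set.univ MeasurableSet.univ
  -- The density belongs to the fiber over `σω`, so the index is pulled back by `σ⁻¹`; the factor
  -- `a` undoes the normalization.
  refine ⟨fun p => a (S.σ.symm p.1.1) * (ρ (S.σ.symm p.1.1) p.1.2).toReal, ?_, fun ω => ?_⟩
  · have h1 : Measurable fun p : S.𝒳 => S.σ.symm p.1.1 :=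
      S.σ.symm.measurable.comp (measurable_fst.comp measurable_subtype_coe)
    exact (ham.comp h1).mul
      (hρm.comp (h1.prodMk (measurable_snd.comp measurable_subtype_coe))).ennreal_toReal
  have hsect : sect (fun p : S.𝒳 => a (S.σ.symm p.1.1) * (ρ (S.σ.symm p.1.1) p.1.2).toReal)
      (S.σ ω) = fun y : fiber S.𝒳 (S.σ ω) => a ω * (ρ ω (y : X)).toReal := by
    funext y; simp [sect]
  rw [hsect]
  refine ⟨(hρi ω).const_mul _, fun s hs => ?_⟩
  obtain ⟨t, ht, rfl⟩ := hs
  have hρω' : Measurable fun y : fiber S.𝒳 (S.σ ω) => ρ ω (y : X) :=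
    (hρω ω).comp measurable_subtype_coe
  rw [integral_const_mul, integral_toReal hρω'.aemeasurable (ae_lt_top hρω' (hfin ω t ht)),
    hlin ω t ht, hκ,
    Measure.map_apply (hTm ω) ht, withDensity_apply _ (hTm ω ht),
    ← ofReal_integral_eq_lintegral_ofReal (hg₁i ω).integrableOn (ae_of_all _ fun x => hg₁0 _),
    ENNReal.toReal_ofReal (integral_nonneg (f := sect g₁ ω) fun x => hg₁0 _)]
  have : ∀ x, sect g₁ ω x = (a ω)⁻¹ * sect g ω x := fun x => rfl
  simp only [this]
  rw [integral_const_mul, mul_inv_cancel_left₀ (zero_lt_one.trans_le (ha1 ω)).ne']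
  rfl

theorem exists_measurable_transfer_real [CompactSpace X] [BorelSpace X]
    {g : S.𝒳 → ℝ} (hg : Measurable g) (hi : ∀ ω, Integrable (sect g ω) (S.m ω)) :
    ∃ G : S.𝒳 → ℝ, Measurable G ∧ ∀ ω, Integrable (sect G (S.σ ω)) (S.m (S.σ ω)) ∧
      ∀ s, MeasurableSet s →
        ∫ y in s, sect G (S.σ ω) y ∂(S.m (S.σ ω)) = ∫ x in S.T ω ⁻¹' s, sect g ω x ∂(S.m ω) := by
  have hip : ∀ ω, Integrable (sect (fun p => max (g p) 0) ω) (S.m ω) := fun ω => (hi ω).pos_part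
  have hin : ∀ ω, Integrable (sect (fun p => max (-g p) 0) ω) (S.m ω) := fun ω => (hi ω).neg_part
  obtain ⟨P, hP, hP'⟩ := S.exists_measurable_transfer_nonneg (g := fun p => max (g p) 0)
    (hg.max measurable_const)
    (fun p => le_max_right _ _) hip
  obtain ⟨N, hN, hN'⟩ := S.exists_measurable_transfer_nonneg (g := fun p => max (-g p) 0)
    (hg.neg.max measurable_const)
    (fun p => le_max_right _ _) hin
  refine ⟨fun p => P p - N p, hP.sub hN, fun ω => ⟨(hP' ω).1.sub (hN' ω).1, fun s hs => ?_⟩⟩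
  have h1 : ∀ y, sect (fun p => P p - N p) (S.σ ω) y = sect P (S.σ ω) y - sect N (S.σ ω) y :=
    fun _ => rfl
  have h2 : ∀ x, sect g ω x = sect (fun p => max (g p) 0) ω x - sect (fun p => max (-g p) 0) ω x :=
    fun x => by
      simp only [sect]
      rcases le_total (g ⟨(ω, x.1), x.2⟩) 0 with h | h <;> simp [h]
  simp only [h1]
  rw [integral_sub (hP' ω).1.integrableOn (hN' ω).1.integrableOn, (hP' ω).2 s hs, (hN' ω).2 s hs,
    ← integral_sub (hip ω).integrableOn (hin ω).integrableOn]
  simp only [← h2]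

/-- The transfer operators preserve joint measurability, without exceptional fibers. -/
theorem exists_measurable_transfer [CompactSpace X] [BorelSpace X]
    {g : S.𝒳 → ℂ} (hg : Measurable g) (hi : ∀ ω, Integrable (sect g ω) (S.m ω)) :
    ∃ G : S.𝒳 → ℂ, Measurable G ∧ ∀ ω,
      transferL1 (S.T ω) (S.m ω) (S.m (S.σ ω)) (sect g ω) =ᵐ[S.m (S.σ ω)] sect G (S.σ ω) := by
  obtain ⟨P, hP, hP'⟩ := S.exists_measurable_transfer_real (Complex.measurable_re.comp hg)
    (fun ω => (hi ω).re)
  obtain ⟨N, hN, hN'⟩ := S.exists_measurable_transfer_real (Complex.measurable_im.comp hg)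
    (fun ω => (hi ω).im)
  refine ⟨fun p => P p + N p * Complex.I, (Complex.measurable_ofReal.comp hP).add
    ((Complex.measurable_ofReal.comp hN).mul_const _), fun ω => ?_⟩
  have hPi : Integrable (fun y => ((sect P (S.σ ω) y : ℝ) : ℂ)) (S.m (S.σ ω)) := (hP' ω).1.ofReal
  have hNi : Integrable (fun y => ((sect N (S.σ ω) y : ℝ) : ℂ) * Complex.I) (S.m (S.σ ω)) :=
    (hN' ω).1.ofReal.mul_const _
  refine transferL1_ae_eq (S.measurable_fiberMap ω) (S.nonsingular ω) (hi ω) (hPi.add hNi)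
    fun s hs => ?_
  have h1 : ∀ y, sect (fun p => (P p : ℂ) + N p * Complex.I) (S.σ ω) y =
    ((sect P (S.σ ω) y : ℝ) : ℂ) + ((sect N (S.σ ω) y : ℝ) : ℂ) * Complex.I := fun _ => rfl
  simp only [h1]
  rw [integral_add hPi.integrableOn hNi.integrableOn, integral_mul_const,
    integral_complex_ofReal, integral_complex_ofReal, (hP' ω).2 s hs, (hN' ω).2 s hs]
  exact integral_re_add_im (hi ω).integrableOn

variable {S}

theorem MeasurableVec.integrable_sect {w : ∀ ω, S.B ω} {g : S.𝒳 → ℂ}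
    (h : ∀ ω, (w ω).val =ᵐ[S.m ω] sect g ω) (ω : Ω) : Integrable (sect g ω) (S.m ω) :=
  (L1.integrable_coeFn (w ω).val).congr (h ω)

theorem MeasurableVec.add {w z : ∀ ω, S.B ω} (hw : S.MeasurableVec w) (hz : S.MeasurableVec z) :
    S.MeasurableVec fun ω => w ω + z ω := by
  obtain ⟨g, hg, hg'⟩ := hw
  obtain ⟨h, hh, hh'⟩ := hz
  refine ⟨fun p => g p + h p, hg.add hh, fun ω => ?_⟩
  filter_upwards [hg' ω, hh' ω, Lp.coeFn_add (w ω).val (z ω).val] with x h1 h2 h3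
  rw [Variation.Space.val_add, h3, Pi.add_apply, h1, h2]
  rfl

theorem MeasurableVec.smul {w : ∀ ω, S.B ω} (hw : S.MeasurableVec w) {a : Ω → ℂ}
    (ha : Measurable a) : S.MeasurableVec fun ω => a ω • w ω := by
  obtain ⟨g, hg, hg'⟩ := hw
  refine ⟨fun p => a p.1.1 * g p,
    (ha.comp (measurable_fst.comp measurable_subtype_coe)).mul hg, fun ω => ?_⟩
  filter_upwards [hg' ω, Lp.coeFn_smul (a ω) (w ω).val] with x h1 h2
  rw [Variation.Space.val_smul, h2, Pi.smul_apply, h1]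
  rfl

theorem MeasurableVec.of_ae_eq_mul {w z : ∀ ω, S.B ω} (hw : S.MeasurableVec w) {h : S.𝒳 → ℂ}
    (hh : Measurable h) (hz : ∀ ω, (z ω).val =ᵐ[S.m ω] fun x => sect h ω x * (w ω).val x) :
    S.MeasurableVec z := by
  obtain ⟨g, hg, hg'⟩ := hw
  refine ⟨fun p => h p * g p, hh.mul hg, fun ω => ?_⟩
  filter_upwards [hg' ω, hz ω] with x h1 h2
  rw [h2, h1]
  rfl

theorem MeasurableVec.zero : S.MeasurableVec fun _ => 0 :=
  ⟨fun _ => 0, measurable_const, fun _ => Lp.coeFn_zero _ _ _⟩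

/-- Convergence in `𝓑_ω` is convergence almost everywhere on the fiber, so the pointwise `limUnder`
of the representatives, which is measurable, represents the limit. -/
theorem MeasurableVec.tendsto {w : ℕ → ∀ ω, S.B ω} {z : ∀ ω, S.B ω}
    (hw : ∀ n, S.MeasurableVec (w n)) (h : ∀ ω, Tendsto (fun n => w n ω) atTop (𝓝 (z ω))) :
    S.MeasurableVec z := by
  choose g hg hg' using hw
  refine ⟨fun p => limUnder atTop fun n => g n p,
    (StronglyMeasurable.limUnder fun n => (hg n).stronglyMeasurable).measurable, fun ω => ?_⟩
  filter_upwards [Variation.Space.ae_tendsto (h ω), ae_all_iff.2 fun n => hg' n ω] with x h1 h2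
  simp only [h2] at h1
  exact h1.limUnder_eq.symm

theorem MeasurableVec.measurable_integral {w : ∀ ω, S.B ω} (hw : S.MeasurableVec w) :
    Measurable fun ω => (S.V ω).intCLM (w ω) := by
  obtain ⟨g, hg, hg'⟩ := hw
  have := S.measurable_integral_sect hg (MeasurableVec.integrable_sect hg')
  convert this using 2 with ω
  exact integral_congr_ae (hg' ω)

theorem MeasurableVec.transfer [CompactSpace X] [BorelSpace X] {w z : ∀ ω, S.B ω}
    (hw : S.MeasurableVec w) {A : Set Ω} (hA : MeasurableSet A)
    (h1 : ∀ ω ∈ A, (z (S.σ ω)).val = S.transfer ω (w ω).val) (h0 : ∀ ω ∉ A, z (S.σ ω) = 0) :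
    S.MeasurableVec z := by
  obtain ⟨g, hg, hg'⟩ := hw
  obtain ⟨G, hG, hG'⟩ := S.exists_measurable_transfer hg (MeasurableVec.integrable_sect hg')
  refine ⟨{p : S.𝒳 | S.σ.symm p.1.1 ∈ A}.indicator G, hG.indicator ((S.σ.symm.measurable.comp
    (measurable_fst.comp measurable_subtype_coe)) hA), fun ω => ?_⟩
  obtain ⟨ω, rfl⟩ := S.σ.surjective ω
  by_cases hω : ω ∈ A
  · rw [h1 ω hω, RandomSystem.transfer, transferL1_congr (hg' ω)]
    filter_upwards [hG' ω] with x hx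
    rw [hx]
    simp [sect, Set.indicator, hω]
  · rw [h0 ω hω]
    filter_upwards [Lp.coeFn_zero ℂ 1 (S.m (S.σ ω))] with x hx
    rw [Variation.Space.val_zero, hx]
    simp [sect, Set.indicator, hω]

end RandomSystem

end

/-! ### Operator exponentials, invertibility, analytic eigenvectors. -/

noncomputable section

section BanachSpace

variable {E G : Type*} [NormedAddCommGroup E] [NormedSpace ℂ E] [CompleteSpace E]
  [NormedAddCommGroup G] [NormedSpace ℂ G] [CompleteSpace G]

/-- Applied to evaluation at a base point, this makes the exponential on the space of families act
fiberwise. -/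
theorem exp_intertwine (J : E →L[ℂ] G) {a : E →L[ℂ] E} {b : G →L[ℂ] G}
    (h : ∀ x, J (a x) = b (J x)) (x : E) :
    J (NormedSpace.exp a x) = NormedSpace.exp b (J x) := by
  have hpow : ∀ (n : ℕ) x, J ((a ^ n) x) = (b ^ n) (J x) := fun n => by
    induction n with
    | zero => intro x; rfl
    | succ n ih => intro x; rw [pow_succ, pow_succ]; exact (ih (a x)).trans (by rw [h]; rfl)
  have h1 := (J.comp (ContinuousLinearMap.apply ℂ E x)).hasSum
    (NormedSpace.exp_series_hasSum_exp' (𝕂 := ℂ) a)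
  have h2 := (ContinuousLinearMap.apply ℂ G (J x)).hasSum
    (NormedSpace.exp_series_hasSum_exp' (𝕂 := ℂ) b)
  refine h1.unique (h2.congr_fun ?_)
  intro n
  change J ((n.factorial : ℂ)⁻¹ • (a ^ n) x) = (n.factorial : ℂ)⁻¹ • (b ^ n) (J x)
  rw [map_smul, hpow]

theorem norm_exp_sub_one_le_of_norm_le (a : E →L[ℂ] E) {t : ℝ} (h : ‖a‖ ≤ t) :
    ‖NormedSpace.exp a - 1‖ ≤ Real.exp t - 1 := by
  have ht : 0 ≤ t := (norm_nonneg a).trans h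
  have h1 := (hasSum_nat_add_iff' 1).2 (NormedSpace.exp_series_hasSum_exp' (𝕂 := ℂ) a)
  have h2 := (hasSum_nat_add_iff' 1).2 (NormedSpace.exp_series_hasSum_exp' (𝕂 := ℝ) t)
  simp only [Finset.sum_range_one, Nat.factorial_zero, Nat.cast_one, inv_one, pow_zero, one_smul]
    at h1 h2
  rw [← Real.exp_eq_exp_ℝ] at h2
  rw [← h1.tsum_eq]
  refine tsum_of_norm_bounded h2 fun n => ?_
  rw [norm_smul, smul_eq_mul, norm_inv, Complex.norm_natCast]
  gcongr
  exact (norm_pow_le' a n.succ_pos).trans (by gcongr)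

/-- Some power has norm below `1`, so `1 - N^n` is a unit; it is the product of `1 - N` and the
commuting geometric sum, hence both factors are units. -/
theorem isUnit_one_sub_of_norm_pow_le {N : E →L[ℂ] E} {C r : ℝ} (hr0 : 0 ≤ r) (hr : r < 1)
    (h : ∀ n ≥ 1, ‖N ^ n‖ ≤ C * r ^ n) : IsUnit (1 - N) := by
  have ht : Tendsto (fun n : ℕ => C * r ^ n) atTop (𝓝 0) := by
    simpa using (tendsto_pow_atTop_nhds_zero_of_lt_one hr0 hr).const_mul C
  obtain ⟨n, hn, hn1⟩ := ((ht.eventually_lt_const one_pos).and (eventually_ge_atTop 1)).exists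
  have h1 : IsUnit (1 - N ^ n) := isUnit_one_sub_of_norm_lt_one ((h n hn1).trans_lt hn)
  rw [← mul_neg_geom_sum N n] at h1
  have hc : Commute (1 - N) (∑ i ∈ Finset.range n, N ^ i) :=
    (Commute.one_left _).sub_left (Commute.sum_right _ _ _ fun i _ => (Commute.refl N).pow_right i)
  exact (hc.isUnit_mul_iff.1 h1).1

/-- Analytic continuation of an eigenvector: `b (A θ u) u` is `A θ u` normalized by its
eigenvalue. -/
theorem exists_analytic_eigenvector {A : ℂ → E →L[ℂ] E} (hA : AnalyticAt ℂ A 0)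
    (b : E →L[ℂ] E →L[ℂ] E) {v : E} (hv : A 0 v = v) (hb : ∀ w, b v w = w)
    (hinv : IsUnit (1 - (A 0 - (b.flip v).comp (A 0)))) :
    ∃ u : ℂ → E, u 0 = v ∧ AnalyticAt ℂ u 0 ∧
      ∀ᶠ θ in 𝓝 0, A θ (u θ) = b (A θ (u θ)) (u θ) := by
  set G : ℂ × E → E := fun p => A p.1 p.2 - b (A p.1 p.2) p.2 with hG
  have hA' : ContDiffAt ℂ ⊤ A (0, v).1 := hA.contDiffAt
  have hGc : ContDiffAt ℂ ⊤ G (0, v) := by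
    have h1 : ContDiffAt ℂ ⊤ (fun p : ℂ × E => A p.1 p.2) (0, v) :=
      (hA'.comp (0, v) contDiffAt_fst).clm_apply contDiffAt_snd
    exact h1.sub ((b.contDiff.contDiffAt.comp _ h1).clm_apply contDiffAt_snd)
  have hG0 : G (0, v) = 0 := by simp [hG, hv, hb]
  -- The bilinear term contributes `b (A 0 v) w = b v w = w`, which is the `1`, and `b (A 0 w) v`,
  -- which corrects `A 0`.
  have hder : fderiv ℂ G (0, v) ∘L .inr ℂ ℂ E = -(1 - (A 0 - (b.flip v).comp (A 0))) := by
    have h1 : HasFDerivAt (fun w => G (0, w)) (fderiv ℂ G (0, v) ∘L .inr ℂ ℂ E) v :=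
      (hGc.differentiableAt (by simp)).hasFDerivAt.comp v (hasFDerivAt_prodMk_right 0 v)
    have h2 : HasFDerivAt (fun w => G (0, w)) (A 0 - (((b (A 0 v)).comp (.id ℂ E)) +
        (b.comp (A 0)).flip v)) v := by
      refine (A 0).hasFDerivAt.sub ?_
      exact ((b.comp (A 0)).hasFDerivAt).clm_apply (hasFDerivAt_id v)
    rw [h1.unique h2]
    ext w
    simp [hv, hb]
    abel
  have hI : (fderiv ℂ G (0, v) ∘L .inr ℂ ℂ E).IsInvertible := by
    rw [hder]
    obtain ⟨e, he⟩ := hinv.neg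
    exact ⟨ContinuousLinearEquiv.unitsEquiv ℂ E e, he⟩
  refine ⟨hGc.implicitFunction (by simp) hI, hGc.implicitFunction_apply_self _ hI,
    (hGc.contDiffAt_implicitFunction _ hI).analyticAt, ?_⟩
  filter_upwards [hGc.eventually_apply_implicitFunction (by simp) hI] with θ hθ
  rw [hG0] at hθ
  exact sub_eq_zero.1 hθ

end BanachSpace

/-! ### Perturbed cocycles: transversal contraction, dual functionals, spectral gap. -/

section Cocycle

variable {I : Type*} {σ : I → I} {E : I → Type*} [∀ i, NormedAddCommGroup (E i)]
  [∀ i, NormedSpace ℂ (E i)]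

/-- The iterates `A_{σ^{n-1} i} ∘ ⋯ ∘ A_{σ i} ∘ A_i` of a family of operators over `σ`. -/
def cocycleIter (A : ∀ i, E i →L[ℂ] E (σ i)) : (n : ℕ) → (i : I) → E i →L[ℂ] E (σ^[n] i)
  | 0, i => ContinuousLinearMap.id ℂ (E i)
  | n + 1, i => (cocycleIter A n (σ i)).comp (A i)

theorem cocycleIter_succ_apply (A : ∀ i, E i →L[ℂ] E (σ i)) (n : ℕ) (i : I) (h : E i) :
    cocycleIter A (n + 1) i h = cocycleIter A n (σ i) (A i h) := rfl

theorem cocycleIter_smul (A : ∀ i, E i →L[ℂ] E (σ i)) (l : I → ℂ) (n : ℕ) (i : I) :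
    cocycleIter (fun i => l i • A i) n i =
      (∏ k ∈ Finset.range n, l (σ^[k] i)) • cocycleIter A n i := by
  induction n generalizing i with
  | zero => rw [Finset.prod_range_zero]; exact (one_smul ℂ _).symm
  | succ n ih =>
    rw [cocycleIter, ih, Finset.prod_range_succ']
    change ((∏ k ∈ Finset.range n, l (σ^[k] (σ i))) • cocycleIter A n (σ i)).comp (l i • A i) =
      ((∏ k ∈ Finset.range n, l (σ^[k] (σ i))) * l i) • (cocycleIter A n (σ i)).comp (A i)
    rw [ContinuousLinearMap.smul_comp, ContinuousLinearMap.comp_smul, smul_smul]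

theorem differentiableOn_cocycleIter {U : Set ℂ} {A : ℂ → ∀ i, E i →L[ℂ] E (σ i)} {J : Set I}
    (hJ : ∀ i ∈ J, σ i ∈ J) (hA : ∀ i ∈ J, DifferentiableOn ℂ (fun θ => A θ i) U) (n : ℕ) :
    ∀ i ∈ J, DifferentiableOn ℂ (fun θ => cocycleIter (A θ) n i) U := by
  induction n with
  | zero => intro i _; exact differentiableOn_const _
  | succ n ih => intro i hi; exact (ih _ (hJ i hi)).clm_comp (hA i hi)

/-- A perturbation of an exponentially contracting cocycle on an invariant family of subspaces is
exponentially contracting. -/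
theorem norm_cocycleIter_le_of_perturbation {L Q : ∀ i, E i →L[ℂ] E (σ i)} {J : Set I}
    {Z : ∀ i, E i → Prop} {D r ε : ℝ} (hr : 0 ≤ r) (hD : 0 ≤ D) (hε : 0 ≤ ε)
    (hJ : ∀ i ∈ J, σ i ∈ J)
    (hQ : ∀ i ∈ J, ∀ h, Z i h → Z (σ i) (Q i h)) (hQL : ∀ i ∈ J, ∀ h, Z i h → Z (σ i) (Q i h - L i h))
    (hL : ∀ i ∈ J, ∀ h, Z i h → ∀ n, ‖cocycleIter L n i h‖ ≤ D * r ^ n * ‖h‖)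
    (hd : ∀ i ∈ J, ∀ h, Z i h → ‖Q i h - L i h‖ ≤ ε * ‖h‖) (n : ℕ) :
    ∀ i ∈ J, ∀ h, Z i h → ‖cocycleIter Q n i h‖ ≤ D * (r + D * ε) ^ n * ‖h‖ := by
  -- Here `c` bounds the adapted norm `sup_k r^{-k} ‖L^k h‖`, which is at most `D ‖h‖`. One step of
  -- `L` multiplies it by at most `r`, and the error `Q - L` adds at most `D ε c`. Working with it
  -- keeps the factor `D` from accumulating along the iteration.
  have key : ∀ n, ∀ i ∈ J, ∀ h, Z i h → ∀ c, (∀ k, ‖cocycleIter L k i h‖ ≤ c * r ^ k) →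
      ‖cocycleIter Q n i h‖ ≤ c * (r + D * ε) ^ n := by
    intro n
    induction n with
    | zero => intro i _ h _ c hc; exact hc 0
    | succ n ih =>
      intro i hi h hz c hc
      have h0 : ‖h‖ ≤ c := (hc 0).trans_eq (by simp)
      rw [cocycleIter_succ_apply, pow_succ', ← mul_assoc]
      refine ih (σ i) (hJ i hi) _ (hQ i hi h hz) _ fun k => ?_
      have h1 : Q i h = L i h + (Q i h - L i h) := by abel
      rw [h1, map_add]
      refine (norm_add_le _ _).trans ?_
      have h2 := hc (k + 1)
      rw [cocycleIter_succ_apply] at h2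
      have h3 := hL (σ i) (hJ i hi) _ (hQL i hi h hz) k
      have h4 : D * r ^ k * ‖Q i h - L i h‖ ≤ D * r ^ k * (ε * c) := by
        gcongr
        exact (hd i hi h hz).trans (by gcongr)
      calc _ ≤ c * r ^ (k + 1) + D * r ^ k * (ε * c) := add_le_add h2 (h3.trans h4)
        _ = _ := by ring
  intro i hi h hz
  have := key n i hi h hz (D * ‖h‖) fun k => (hL i hi h hz k).trans_eq (by ring)
  exact this.trans_eq (by ring)

/-- Data of a normalized cocycle `M` over `σ` with invariant vectors `u`, close on `J` to a cocycle
`L` that preserves the functionals `μ` and contracts their kernels exponentially. -/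
structure NormalizedCocycle (σ : I → I) (E : I → Type*) [∀ i, NormedAddCommGroup (E i)]
    [∀ i, NormedSpace ℂ (E i)] (J : Set I) (μ : ∀ i, E i →L[ℂ] ℂ) (L M : ∀ i, E i →L[ℂ] E (σ i))
    (u : ∀ i, E i) (D r ε C : ℝ) : Prop where
  mapsTo : ∀ i ∈ J, σ i ∈ J
  norm_functional_le : ∀ i h, ‖μ i h‖ ≤ ‖h‖
  functional_map : ∀ i ∈ J, ∀ h, μ (σ i) (L i h) = μ i h
  decay : ∀ i ∈ J, ∀ h, μ i h = 0 → ∀ n, ‖cocycleIter L n i h‖ ≤ D * r ^ n * ‖h‖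
  map_vec : ∀ i ∈ J, M i (u i) = u (σ i)
  functional_vec : ∀ i ∈ J, μ i (u i) = 1
  norm_vec_le : ∀ i ∈ J, ‖u i‖ ≤ C
  norm_sub_le : ∀ i ∈ J, ∀ h, ‖M i h - L i h‖ ≤ ε * ‖h‖
  pos_D : 0 < D
  pos_r : 0 < r
  nonneg_ε : 0 ≤ ε
  nonneg_C : 0 ≤ C

namespace NormalizedCocycle

variable {J : Set I} {μ : ∀ i, E i →L[ℂ] ℂ} {L M : ∀ i, E i →L[ℂ] E (σ i)} {u : ∀ i, E i}
  {D r ε C : ℝ}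

/-- The part of `M` transversal to `u`. -/
def transversal (μ : ∀ i, E i →L[ℂ] ℂ) (M : ∀ i, E i →L[ℂ] E (σ i)) (u : ∀ i, E i) (i : I) :
    E i →L[ℂ] E (σ i) :=
  M i - ((μ (σ i)).comp (M i)).smulRight (u (σ i))

theorem transversal_apply (i : I) (h : E i) :
    transversal μ M u i h = M i h - μ (σ i) (M i h) • u (σ i) := rfl

/-- The functionals `μ ∘ M^n`. -/
def functional (μ : ∀ i, E i →L[ℂ] ℂ) (M : ∀ i, E i →L[ℂ] E (σ i)) (n : ℕ) (i : I) : E i →L[ℂ] ℂ :=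
  (μ (σ^[n] i)).comp (cocycleIter M n i)

theorem functional_succ (n : ℕ) (i : I) :
    functional μ M (n + 1) i = (functional μ M n (σ i)).comp (M i) := rfl

theorem norm_transversal_iter_le (H : NormalizedCocycle σ E J μ L M u D r ε C)
    (n : ℕ) {i : I} (hi : i ∈ J) {h : E i} (hz : μ i h = 0) :
    ‖cocycleIter (transversal μ M u) n i h‖ ≤ D * (r + D * ((1 + C) * ε)) ^ n * ‖h‖ := by
  have hC := H.nonneg_C
  have hε := H.nonneg_ε
  have hZ : ∀ i ∈ J, ∀ h, μ (σ i) (transversal μ M u i h) = 0 := fun i hi h => by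
    rw [transversal_apply, map_sub, map_smul, H.functional_vec _ (H.mapsTo i hi)]
    simp
  refine norm_cocycleIter_le_of_perturbation (L := L) (J := J) (Z := fun i h => μ i h = 0)
    H.pos_r.le H.pos_D.le (by positivity) H.mapsTo (fun i hi h _ => hZ i hi h)
    (fun i hi h hz => ?_) H.decay (fun i hi h hz => ?_) n i hi h hz
  · rw [map_sub, hZ i hi, H.functional_map i hi, hz, sub_zero]
  · have h1 : transversal μ M u i h - L i h =
        (M i h - L i h) - μ (σ i) (M i h - L i h) • u (σ i) := by
      rw [transversal_apply, map_sub, H.functional_map i hi, hz, sub_zero]; abel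
    rw [h1]
    refine (_root_.norm_sub_le _ _).trans ?_
    rw [norm_smul]
    have h2 := H.norm_sub_le i hi h
    have h3 := H.norm_vec_le _ (H.mapsTo i hi)
    have h4 := (H.norm_functional_le (σ i) (M i h - L i h)).trans h2
    calc _ ≤ ε * ‖h‖ + ε * ‖h‖ * C := by gcongr
      _ = _ := by ring

theorem norm_sub_functional_smul_le (H : NormalizedCocycle σ E J μ L M u D r ε C)
    {i : I} (hi : i ∈ J) (h : E i) :
    ‖h - μ i h • u i‖ ≤ (1 + C) * ‖h‖ := by
  refine (_root_.norm_sub_le _ _).trans ?_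
  rw [norm_smul]
  have h1 := H.norm_functional_le i h
  have h2 := H.norm_vec_le i hi
  calc _ ≤ ‖h‖ + ‖h‖ * C := by gcongr
    _ = _ := by ring

theorem functional_sub_vec (H : NormalizedCocycle σ E J μ L M u D r ε C)
    {i : I} (hi : i ∈ J) (h : E i) : μ i (h - μ i h • u i) = 0 := by
  rw [map_sub, map_smul, H.functional_vec i hi]; simp

theorem transversal_vec (H : NormalizedCocycle σ E J μ L M u D r ε C)
    {i : I} (hi : i ∈ J) (c : ℂ) (h : E i) :
    transversal μ M u i (h - c • u i) = transversal μ M u i h := by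
  have h1 : transversal μ M u i (u i) = 0 := by
    rw [transversal_apply, H.map_vec i hi, H.functional_vec _ (H.mapsTo i hi), one_smul, sub_self]
  rw [map_sub, map_smul, h1, smul_zero, sub_zero]

/-- `M h` splits into `μ (M h) • u` and `Q h`, where `Q` is the transversal part; the first piece is
carried along `u` by `M`, and `Q` kills `u`. -/
theorem iter_eq (H : NormalizedCocycle σ E J μ L M u D r ε C)
    (n : ℕ) : ∀ i ∈ J, ∀ h, cocycleIter M n i h =
    functional μ M n i h • u (σ^[n] i) + cocycleIter (transversal μ M u) n i (h - μ i h • u i) := by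
  induction n with
  | zero =>
    intro i _ h
    change h = μ i h • u i + (h - μ i h • u i)
    abel
  | succ n ih =>
    intro i hi h
    rw [cocycleIter_succ_apply, ih (σ i) (H.mapsTo i hi), cocycleIter_succ_apply,
      H.transversal_vec hi, ← transversal_apply]
    rfl

theorem functional_apply_vec (H : NormalizedCocycle σ E J μ L M u D r ε C)
    (n : ℕ) : ∀ i ∈ J, functional μ M n i (u i) = 1 := by
  induction n with
  | zero => intro i hi; exact H.functional_vec i hi
  | succ n ih =>
    intro i hi
    rw [functional_succ, ContinuousLinearMap.comp_apply, H.map_vec i hi, ih _ (H.mapsTo i hi)]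

/-- All the functionals equal `1` on `u`, so their differences only see `ψ = h - μ h • u`. For `n =
0` the difference is `μ (M ψ - L ψ)`, because `L` preserves `μ`. Replacing `h` by `M h` replaces `ψ`
by its image under the transversal part, which is the induction. -/
theorem functional_succ_sub (H : NormalizedCocycle σ E J μ L M u D r ε C) (n : ℕ) : ∀ i ∈ J, ∀ h,
    ‖functional μ M (n + 1) i h - functional μ M n i h‖ ≤
      ε * ‖cocycleIter (transversal μ M u) n i (h - μ i h • u i)‖ := by
  have hu : ∀ n, ∀ i ∈ J, ∀ h (c : ℂ),
      functional μ M (n + 1) i (h - c • u i) - functional μ M n i (h - c • u i) =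
        functional μ M (n + 1) i h - functional μ M n i h := fun n i hi h c => by
    simp only [map_sub, map_smul, H.functional_apply_vec _ i hi]; ring
  induction n with
  | zero =>
    intro i hi h
    rw [← hu 0 i hi h (μ i h)]
    set ψ := h - μ i h • u i
    have h1 : functional μ M (0 + 1) i ψ - functional μ M 0 i ψ = μ (σ i) (M i ψ - L i ψ) := by
      rw [map_sub (μ (σ i)), H.functional_map i hi]; rfl
    rw [h1]
    exact (H.norm_functional_le _ _).trans (H.norm_sub_le i hi ψ)
  | succ n ih =>
    intro i hi h
    rw [functional_succ, functional_succ, ContinuousLinearMap.comp_apply,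
      ContinuousLinearMap.comp_apply]
    refine (ih (σ i) (H.mapsTo i hi) (M i h)).trans_eq ?_
    rw [cocycleIter_succ_apply, H.transversal_vec hi, ← transversal_apply]
    rfl

theorem norm_functional_succ_sub_le (H : NormalizedCocycle σ E J μ L M u D r ε C)
    (n : ℕ) {i : I} (hi : i ∈ J) :
    dist (functional μ M n i) (functional μ M (n + 1) i) ≤
      (ε * D * (1 + C)) * (r + D * ((1 + C) * ε)) ^ n := by
  have hC := H.nonneg_C
  have hε := H.nonneg_ε
  have hD := H.pos_D
  have hr := H.pos_r
  rw [dist_comm, dist_eq_norm]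
  refine ContinuousLinearMap.opNorm_le_bound _ (by positivity) fun h => ?_
  refine (H.functional_succ_sub n i hi h).trans ?_
  have h1 := H.norm_transversal_iter_le n hi (H.functional_sub_vec hi h)
  have h2 := H.norm_sub_functional_smul_le hi h
  calc _ ≤ ε * (D * (r + D * ((1 + C) * ε)) ^ n * ((1 + C) * ‖h‖)) := by
        gcongr
        exact h1.trans (by gcongr)
    _ = _ := by ring

theorem exists_limit (H : NormalizedCocycle σ E J μ L M u D r ε C)
    (hx : r + D * ((1 + C) * ε) < 1) {i : I} (hi : i ∈ J) :
    ∃ φ : E i →L[ℂ] ℂ, Tendsto (fun n => functional μ M n i) atTop (𝓝 φ) ∧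
      ∀ n, ‖functional μ M n i - φ‖ ≤ (ε * D * (1 + C)) / (1 - (r + D * ((1 + C) * ε))) *
        (r + D * ((1 + C) * ε)) ^ n := by
  obtain ⟨φ, hφ⟩ := cauchySeq_tendsto_of_complete
    (cauchySeq_of_le_geometric _ _ hx fun n => H.norm_functional_succ_sub_le n hi)
  refine ⟨φ, hφ, fun n => ?_⟩
  rw [← dist_eq_norm]
  exact (dist_le_of_le_geometric_of_tendsto _ _ hx
    (fun n => H.norm_functional_succ_sub_le n hi) hφ n).trans_eq (by ring)

/-- In the decomposition `iter_eq` there are two errors of the same rate: the transversal iterate,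
and the distance of `functional μ M n i` from its limit. -/
theorem norm_iter_sub_le (H : NormalizedCocycle σ E J μ L M u D r ε C)
    (hx : r + D * ((1 + C) * ε) < 1) {i : I} (hi : i ∈ J) {φ : E i →L[ℂ] ℂ}
    (hφ : Tendsto (fun n => functional μ M n i) atTop (𝓝 φ)) (n : ℕ) (h : E i) :
    ‖cocycleIter M n i h - φ h • u (σ^[n] i)‖ ≤
      (D * (1 + C) + (ε * D * (1 + C)) / (1 - (r + D * ((1 + C) * ε))) * C) *
        (r + D * ((1 + C) * ε)) ^ n * ‖h‖ := by
  have hC := H.nonneg_C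
  have hε := H.nonneg_ε
  have hD := H.pos_D
  have hr := H.pos_r
  set x := r + D * ((1 + C) * ε)
  have hx0 : 0 ≤ x := by positivity
  have hx1 : 0 < 1 - x := by linarith
  obtain ⟨φ', hφ', hb⟩ := H.exists_limit hx hi
  obtain rfl := tendsto_nhds_unique hφ hφ'
  have hmem : ∀ n, ∀ i ∈ J, σ^[n] i ∈ J := fun n => by
    induction n with
    | zero => intro i hi; exact hi
    | succ n ih => intro i hi; exact ih _ (H.mapsTo i hi)
  have h1 : cocycleIter M n i h - φ h • u (σ^[n] i) =
      (functional μ M n i - φ) h • u (σ^[n] i) +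
        cocycleIter (transversal μ M u) n i (h - μ i h • u i) := by
    rw [H.iter_eq n i hi h, sub_apply, sub_smul]; abel
  rw [h1]
  refine (norm_add_le _ _).trans ?_
  rw [norm_smul]
  have h2 := (H.norm_transversal_iter_le n hi (H.functional_sub_vec hi h)).trans
    (mul_le_mul_of_nonneg_left (H.norm_sub_functional_smul_le hi h) (by positivity))
  have h3 := H.norm_vec_le _ (hmem n i hi)
  have h4 : ‖(functional μ M n i - φ) h‖ ≤ (ε * D * (1 + C)) / (1 - x) * x ^ n * ‖h‖ :=
    (ContinuousLinearMap.le_opNorm _ h).trans (by gcongr; exact hb n)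
  calc _ ≤ (ε * D * (1 + C)) / (1 - x) * x ^ n * ‖h‖ * C + D * x ^ n * ((1 + C) * ‖h‖) := by
        gcongr
    _ = _ := by ring

end NormalizedCocycle

end Cocycle

end

/-! ### Operators over an invariant set of full measure. -/

noncomputable section

namespace RandomSystem

variable {Ω X : Type*} [MeasurableSpace Ω] {ℙ : Measure Ω} [MetricSpace X] [MeasurableSpace X]

/-- An invariant measurable set `A` of base points on which the admissibility bounds hold without
exception, together with the classes `f ω ∈ 𝓑_ω` of the observable `F`. -/
structure RegularData (S : RandomSystem Ω X ℙ) (F : S.𝒳 → ℝ) where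
  A : Set Ω
  K : ℝ
  D : ℝ
  r : ℝ
  b : ℝ
  f : ∀ ω, S.B ω
  measurableSet_A : MeasurableSet A
  mem_iff : ∀ ω, S.σ ω ∈ A ↔ ω ∈ A
  pos_K : 0 < K
  pos_D : 0 < D
  pos_r : 0 < r
  r_lt_one : r < 1
  pos_b : 0 < b
  measurable_F : Measurable F
  bounded : ∀ ω ∈ A, ∀ φ : Lp ℂ 1 (S.m ω), (S.V ω).var φ < ∞ →
    (S.V (S.σ ω)).bnorm (S.transfer ω φ) ≤ ENNReal.ofReal K * (S.V ω).bnorm φ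
  decay : ∀ ω ∈ A, ∀ n : ℕ, ∀ φ : Lp ℂ 1 (S.m ω),
    (S.V ω).var φ < ∞ → ∫ x, φ x ∂(S.m ω) = 0 →
    (S.V (S.σ^[n] ω)).bnorm (S.transferIter n ω φ) ≤
      ENNReal.ofReal (D * r ^ n) * (S.V ω).bnorm φ
  f_ae_eq : ∀ ω, (f ω).val =ᵐ[S.m ω] csect F ω
  norm_mul_f_le : ∀ ω ∈ A, ‖Variation.mulCLM (f ω)‖ ≤ b

theorem iterOp_eq_cocycleIter (S : RandomSystem Ω X ℙ) (L : ∀ ω, S.B ω →L[ℂ] S.B (S.σ ω)) (n : ℕ)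
    (ω : Ω) : S.iterOp L n ω = cocycleIter (σ := S.σ) (E := S.B) L n ω := by
  induction n generalizing ω with
  | zero => rfl
  | succ n ih => exact congrArg (fun T => ContinuousLinearMap.comp T (L ω)) (ih (S.σ ω))

/-- The action of a family of operators `𝓑_ω → 𝓑_{σω}` on families of vectors. -/
def push (S : RandomSystem Ω X ℙ) (L : ∀ ω, S.B ω →L[ℂ] S.B (S.σ ω)) (w : ∀ ω, S.B ω) (ω : Ω) :
    S.B ω :=
  cast (congrArg S.B (S.σ.apply_symm_apply ω)) (L (S.σ.symm ω) (w (S.σ.symm ω)))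

/-- The cast disappears at points written as `σ ω`, and every point has this form; pushed families
are therefore only studied there. -/
theorem push_apply (S : RandomSystem Ω X ℙ) (L : ∀ ω, S.B ω →L[ℂ] S.B (S.σ ω)) (w : ∀ ω, S.B ω)
    (ω : Ω) : S.push L w (S.σ ω) = L ω (w ω) := by
  have key : ∀ ω' (_ : ω' = ω) (h : S.B (S.σ ω') = S.B (S.σ ω)),
      cast h (L ω' (w ω')) = L ω (w ω) := by
    rintro _ rfl _; rfl
  exact key _ (S.σ.symm_apply_apply ω) _

namespace RegularData

variable {S : RandomSystem Ω X ℙ} {F : S.𝒳 → ℝ} (R : S.RegularData F)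

theorem iterate_mem (n : ℕ) : ∀ ω ∈ R.A, S.σ^[n] ω ∈ R.A := by
  induction n with
  | zero => intro ω hω; exact hω
  | succ n ih => intro ω hω; exact ih _ ((R.mem_iff ω).2 hω)

theorem transfer_var_lt {ω : Ω} (hω : ω ∈ R.A) (φ : S.B ω) :
    (S.V (S.σ ω)).var (S.transfer ω φ.val) < ∞ :=
  (le_add_self.trans (R.bounded ω hω φ.val φ.var_lt)).trans_lt
    (ENNReal.mul_lt_top ENNReal.ofReal_lt_top φ.bnorm_lt)

open Classical in
/-- The transfer operator `𝓑_ω → 𝓑_{σω}` for `ω ∈ A`, and `0` elsewhere. -/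
def op (ω : Ω) : S.B ω →L[ℂ] S.B (S.σ ω) :=
  if hω : ω ∈ R.A then
    LinearMap.mkContinuous
      { toFun := fun φ => Variation.Space.mk (S.transfer ω φ.val) (R.transfer_var_lt hω φ)
        map_add' := fun φ ψ => Variation.Space.val_injective
          (transferL1_add (S.measurable_fiberMap ω) (S.nonsingular ω) φ.val ψ.val)
        map_smul' := fun c φ => Variation.Space.val_injective
          (transferL1_smul (S.measurable_fiberMap ω) (S.nonsingular ω) c φ.val) }
      R.K fun φ => by
        rw [Variation.Space.norm_le_iff _ (mul_nonneg R.pos_K.le (norm_nonneg _)),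
          ENNReal.ofReal_mul R.pos_K.le, Variation.Space.ofReal_norm]
        exact R.bounded ω hω φ.val φ.var_lt
  else 0

theorem op_val {ω : Ω} (hω : ω ∈ R.A) (φ : S.B ω) : (R.op ω φ).val = S.transfer ω φ.val := by
  rw [op, dif_pos hω]; rfl

theorem op_of_notMem {ω : Ω} (hω : ω ∉ R.A) : R.op ω = 0 := by
  rw [op, dif_neg hω]

theorem norm_op_le (ω : Ω) : ‖R.op ω‖ ≤ R.K := by
  by_cases hω : ω ∈ R.A
  · rw [op, dif_pos hω]; exact LinearMap.mkContinuous_norm_le _ R.pos_K.le _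
  · rw [R.op_of_notMem hω, norm_zero]; exact R.pos_K.le

theorem intCLM_op {ω : Ω} (hω : ω ∈ R.A) (φ : S.B ω) :
    (S.V (S.σ ω)).intCLM (R.op ω φ) = (S.V ω).intCLM φ := by
  rw [Variation.intCLM_apply, R.op_val hω]
  exact integral_transferL1 (S.measurable_fiberMap ω) (S.nonsingular ω) (L1.integrable_coeFn _)

theorem iter_op_val (n : ℕ) : ∀ ω ∈ R.A, ∀ φ : S.B ω,
    (cocycleIter (σ := S.σ) (E := S.B) R.op n ω φ).val = S.transferIter n ω φ.val := by
  induction n with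
  | zero => intro ω _ φ; rfl
  | succ n ih =>
    intro ω hω φ
    have := ih (S.σ ω) ((R.mem_iff ω).2 hω) (R.op ω φ)
    rw [R.op_val hω] at this
    exact this

theorem norm_iter_op_le {ω : Ω} (hω : ω ∈ R.A) (φ : S.B ω) (h0 : (S.V ω).intCLM φ = 0) (n : ℕ) :
    ‖cocycleIter (σ := S.σ) (E := S.B) R.op n ω φ‖ ≤ R.D * R.r ^ n * ‖φ‖ := by
  have hD := R.pos_D
  have hr := R.pos_r
  rw [Variation.Space.norm_le_iff _ (by positivity), R.iter_op_val n ω hω,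
    ENNReal.ofReal_mul (by positivity), Variation.Space.ofReal_norm]
  exact R.decay ω hω n φ.val φ.var_lt h0

/-- The twisted transfer operator. -/
def twisted (θ : ℂ) (ω : Ω) : S.B ω →L[ℂ] S.B (S.σ ω) :=
  (R.op ω).comp (NormedSpace.exp (θ • Variation.mulCLM (R.f ω)))

theorem twisted_zero (ω : Ω) : R.twisted 0 ω = R.op ω := by
  rw [twisted, zero_smul, NormedSpace.exp_zero]; rfl

theorem twisted_of_notMem (θ : ℂ) {ω : Ω} (hω : ω ∉ R.A) : R.twisted θ ω = 0 := by
  rw [twisted, R.op_of_notMem hω, ContinuousLinearMap.zero_comp]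

theorem exp_ae_eq (θ : ℂ) (ω : Ω) (φ : S.B ω) :
    (NormedSpace.exp (θ • Variation.mulCLM (R.f ω)) φ).val =ᵐ[S.m ω]
      fun x => Complex.exp (θ * csect F ω x) * φ.val x := by
  filter_upwards [Variation.exp_mulCLM_ae_eq (R.f ω) φ θ, R.f_ae_eq ω] with x h1 h2
  rw [h1, h2]

theorem isTwisted (θ : ℂ) {ω : Ω} (hω : ω ∈ R.A) : S.IsTwisted F θ ω (R.twisted θ ω) := fun φ => by
  rw [twisted, ContinuousLinearMap.comp_apply, R.op_val hω, transfer,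
    transferL1_congr (R.exp_ae_eq θ ω φ)]

/-- The bound is independent of `ω` and tends to `0` with `θ`: the twist is a uniformly small
perturbation. -/
theorem norm_twisted_sub_le (θ : ℂ) (ω : Ω) :
    ‖R.twisted θ ω - R.op ω‖ ≤ R.K * (Real.exp (‖θ‖ * R.b) - 1) := by
  by_cases hω : ω ∈ R.A
  · have h1 : R.twisted θ ω - R.op ω =
        (R.op ω).comp (NormedSpace.exp (θ • Variation.mulCLM (R.f ω)) - 1) := by
      rw [ContinuousLinearMap.comp_sub]; rfl
    rw [h1]
    refine (ContinuousLinearMap.opNorm_comp_le _ _).trans ?_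
    gcongr
    · exact R.pos_K.le
    · exact R.norm_op_le ω
    · refine norm_exp_sub_one_le_of_norm_le _ ?_
      rw [norm_smul]
      gcongr
      exact R.norm_mul_f_le ω hω
  · rw [R.op_of_notMem hω, R.twisted_of_notMem θ hω, sub_zero, norm_zero]
    refine mul_nonneg R.pos_K.le (sub_nonneg.2 (Real.one_le_exp ?_))
    exact mul_nonneg (norm_nonneg _) R.pos_b.le

theorem differentiable_twisted (ω : Ω) : Differentiable ℂ fun θ => R.twisted θ ω := by
  have h : Differentiable ℂ fun θ : ℂ => NormedSpace.exp (θ • Variation.mulCLM (R.f ω)) := fun θ =>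
    (NormedSpace.exp_analytic (𝕂 := ℂ) (θ • Variation.mulCLM (R.f ω))).differentiableAt.comp θ
      (differentiableAt_id.smul_const _)
  exact (differentiable_const _).clm_comp h

theorem measurableVec_exp {w : ∀ ω, S.B ω} (hw : S.MeasurableVec w) (θ : ℂ) :
    S.MeasurableVec fun ω => NormedSpace.exp (θ • Variation.mulCLM (R.f ω)) (w ω) :=
  hw.of_ae_eq_mul (h := fun p => Complex.exp (θ * (F p : ℂ)))
    (Complex.measurable_exp.comp ((Complex.measurable_ofReal.comp R.measurable_F).const_mul θ))
    fun ω => R.exp_ae_eq θ ω (w ω)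

variable [CompactSpace X] [BorelSpace X]

theorem measurableVec_push_op {w : ∀ ω, S.B ω} (hw : S.MeasurableVec w) :
    S.MeasurableVec (S.push R.op w) :=
  hw.transfer R.measurableSet_A (fun ω hω => by rw [push_apply, R.op_val hω])
    fun ω hω => by rw [push_apply, R.op_of_notMem hω]; rfl

theorem measurableVec_push_twisted {w : ∀ ω, S.B ω} (hw : S.MeasurableVec w) (θ : ℂ) :
    S.MeasurableVec (S.push (R.twisted θ) w) := by
  refine (R.measurableVec_exp hw θ).transfer R.measurableSet_A (fun ω hω => ?_) fun ω hω => ?_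
  · rw [push_apply, twisted, ContinuousLinearMap.comp_apply, R.op_val hω]
  · rw [push_apply, R.twisted_of_notMem θ hω, zero_apply]

end RegularData

end RandomSystem

end

/-! ### The Banach space of bounded measurable families. -/

noncomputable section

namespace RandomSystem.RegularData

variable {Ω X : Type*} [MeasurableSpace Ω] {ℙ : Measure Ω} [MetricSpace X] [MeasurableSpace X]
  {S : RandomSystem Ω X ℙ} {F : S.𝒳 → ℝ} (R : S.RegularData F)

/-- The bounded measurable families of vectors that vanish off `A`. -/
def families : Submodule ℂ (lp S.B ∞) where
  carrier := {w | S.MeasurableVec (fun ω => w ω) ∧ ∀ ω ∉ R.A, w ω = 0}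
  zero_mem' := ⟨MeasurableVec.zero, fun _ _ => rfl⟩
  add_mem' := fun {w z} hw hz => ⟨hw.1.add hz.1, fun ω hω => by
    rw [lp.coeFn_add, Pi.add_apply, hw.2 ω hω, hz.2 ω hω, add_zero]⟩
  smul_mem' := fun c w hw => ⟨hw.1.smul (a := fun _ => c) measurable_const, fun ω hω => by
    rw [lp.coeFn_smul, Pi.smul_apply, hw.2 ω hω, smul_zero]⟩

/-- The Banach space of bounded measurable families of vectors that vanish off `A`. -/
def Fam : Type _ := R.families

instance : NormedAddCommGroup R.Fam := inferInstanceAs (NormedAddCommGroup R.families)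

instance : NormedSpace ℂ R.Fam := inferInstanceAs (NormedSpace ℂ R.families)

/-- The value at `ω` of a family. -/
def ev (ω : Ω) : R.Fam →L[ℂ] S.B ω :=
  LinearMap.mkContinuous
    { toFun := fun w => w.1 ω
      map_add' := fun _ _ => rfl
      map_smul' := fun _ _ => rfl } 1 fun w => by
    rw [one_mul]; exact lp.norm_apply_le_norm ENNReal.top_ne_zero w.1 ω

theorem norm_ev_le (w : R.Fam) (ω : Ω) : ‖R.ev ω w‖ ≤ ‖w‖ :=
  lp.norm_apply_le_norm ENNReal.top_ne_zero w.1 ω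

theorem measurableVec_ev (w : R.Fam) : S.MeasurableVec fun ω => R.ev ω w := w.2.1

theorem ev_of_notMem (w : R.Fam) {ω : Ω} (hω : ω ∉ R.A) : R.ev ω w = 0 := w.2.2 ω hω

theorem norm_le_of_ev {w : R.Fam} {c : ℝ} (hc : 0 ≤ c) (h : ∀ ω, ‖R.ev ω w‖ ≤ c) : ‖w‖ ≤ c :=
  lp.norm_le_of_forall_le hc h

theorem ext_ev {w z : R.Fam} (h : ∀ ω ∈ R.A, R.ev ω w = R.ev ω z) : w = z := by
  refine Subtype.ext (lp.ext (funext fun ω => ?_))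
  by_cases hω : ω ∈ R.A
  · exact h ω hω
  · exact (R.ev_of_notMem w hω).trans (R.ev_of_notMem z hω).symm

theorem ext_ev_map {w z : R.Fam} (h : ∀ ω ∈ R.A, R.ev (S.σ ω) w = R.ev (S.σ ω) z) : w = z := by
  refine R.ext_ev fun ω hω => ?_
  obtain ⟨ω, rfl⟩ := S.σ.surjective ω
  exact h ω ((R.mem_iff ω).1 hω)

/-- A family of vectors as an element of the space of families. -/
def ofFamily (w : ∀ ω, S.B ω) (hw : S.MeasurableVec w) (h0 : ∀ ω ∉ R.A, w ω = 0) (c : ℝ)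
    (hc : ∀ ω, ‖w ω‖ ≤ c) : R.Fam :=
  ⟨⟨w, memℓp_infty ⟨c, by rintro _ ⟨ω, rfl⟩; exact hc ω⟩⟩, hw, h0⟩

@[simp] theorem ev_ofFamily (w : ∀ ω, S.B ω) (hw : S.MeasurableVec w) (h0 : ∀ ω ∉ R.A, w ω = 0)
    (c : ℝ) (hc : ∀ ω, ‖w ω‖ ≤ c) (ω : Ω) : R.ev ω (R.ofFamily w hw h0 c hc) = w ω := rfl

/-- Sup-norm limits are limits in each fiber, and measurability survives these by
`MeasurableVec.tendsto`. -/
theorem isClosed_families : IsClosed (R.families : Set (lp S.B ∞)) := by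
  refine IsSeqClosed.isClosed fun u w hu hw => ?_
  have h1 : ∀ ω, Tendsto (fun n => u n ω) atTop (𝓝 (w ω)) := fun ω => by
    rw [tendsto_iff_norm_sub_tendsto_zero] at hw ⊢
    refine squeeze_zero (fun _ => norm_nonneg _) (fun n => ?_) hw
    exact lp.norm_apply_le_norm ENNReal.top_ne_zero (u n - w) ω
  refine ⟨MeasurableVec.tendsto (fun n => (hu n).1) h1, fun ω hω => ?_⟩
  refine tendsto_nhds_unique (h1 ω) ?_
  simp only [(hu _).2 ω hω]
  exact tendsto_const_nhds

instance : CompleteSpace R.Fam := R.isClosed_families.completeSpace_coe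

theorem norm_int_smul_ev_le (w z : R.Fam) (ω : Ω) :
    ‖(S.V ω).intCLM (R.ev ω w) • R.ev ω z‖ ≤ ‖w‖ * ‖z‖ := by
  rw [norm_smul]
  exact mul_le_mul ((Variation.norm_intCLM_apply_le _).trans (R.norm_ev_le w ω))
    (R.norm_ev_le z ω) (norm_nonneg _) (norm_nonneg _)

/-- The family `(∫ w) z`. -/
def intSMulFam (w z : R.Fam) : R.Fam :=
  R.ofFamily (fun ω => (S.V ω).intCLM (R.ev ω w) • R.ev ω z)
    ((R.measurableVec_ev z).smul (R.measurableVec_ev w).measurable_integral)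
    (fun ω hω => by rw [R.ev_of_notMem z hω, smul_zero]) (‖w‖ * ‖z‖) (R.norm_int_smul_ev_le w z)

theorem ev_intSMulFam (w z : R.Fam) (ω : Ω) :
    R.ev ω (R.intSMulFam w z) = (S.V ω).intCLM (R.ev ω w) • R.ev ω z := rfl

/-- The bilinear map `(w, z) ↦ (∫ w) z`. -/
def intSMul : R.Fam →L[ℂ] R.Fam →L[ℂ] R.Fam :=
  LinearMap.mkContinuous₂
    (LinearMap.mk₂ ℂ R.intSMulFam
      (fun w w' z => R.ext_ev fun ω _ => by
        rw [map_add, ev_intSMulFam, ev_intSMulFam, ev_intSMulFam, map_add, map_add, add_smul])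
      (fun c w z => R.ext_ev fun ω _ => by
        rw [map_smul, ev_intSMulFam, ev_intSMulFam, map_smul, map_smul, smul_eq_mul, mul_smul])
      (fun w z z' => R.ext_ev fun ω _ => by
        rw [map_add, ev_intSMulFam, ev_intSMulFam, ev_intSMulFam, map_add, smul_add])
      (fun c w z => R.ext_ev fun ω _ => by
        rw [map_smul, ev_intSMulFam, ev_intSMulFam, map_smul, smul_comm]))
    1 fun w z => by
      rw [one_mul]
      exact R.norm_le_of_ev (mul_nonneg (norm_nonneg _) (norm_nonneg _)) (R.norm_int_smul_ev_le w z)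

theorem ev_intSMul (w z : R.Fam) (ω : Ω) :
    R.ev ω (R.intSMul w z) = (S.V ω).intCLM (R.ev ω w) • R.ev ω z := rfl

theorem norm_mulCLM_ev_le (w : R.Fam) (ω : Ω) :
    ‖Variation.mulCLM (R.f ω) (R.ev ω w)‖ ≤ R.b * ‖w‖ := by
  have hb := R.pos_b
  by_cases hω : ω ∈ R.A
  · refine (ContinuousLinearMap.le_opNorm _ _).trans ?_
    gcongr
    · exact R.norm_mul_f_le ω hω
    · exact R.norm_ev_le w ω
  · rw [R.ev_of_notMem w hω, map_zero, norm_zero]; positivity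

/-- Multiplication of families by the observable. -/
def famMul : R.Fam →L[ℂ] R.Fam :=
  LinearMap.mkContinuous
    { toFun := fun w => R.ofFamily (fun ω => Variation.mulCLM (R.f ω) (R.ev ω w))
        ((R.measurableVec_ev w).of_ae_eq_mul (h := fun p => (F p : ℂ))
          (Complex.measurable_ofReal.comp R.measurable_F) fun ω => by
            filter_upwards [Variation.mulCLM_ae_eq (R.f ω) (R.ev ω w), R.f_ae_eq ω] with x h1 h2
            rw [h1, h2]; rfl)
        (fun ω hω => by rw [R.ev_of_notMem w hω, map_zero]) _ (R.norm_mulCLM_ev_le w)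
      map_add' := fun w z => R.ext_ev fun ω _ => by simp only [ev_ofFamily, map_add]
      map_smul' := fun c w => R.ext_ev fun ω _ => by
        simp only [ev_ofFamily, map_smul, RingHom.id_apply] }
    R.b fun w => R.norm_le_of_ev (mul_nonneg R.pos_b.le (norm_nonneg _)) (R.norm_mulCLM_ev_le w)

theorem push_op_of_notMem (w : ∀ ω, S.B ω) {ω : Ω} (hω : ω ∉ R.A) : S.push R.op w ω = 0 := by
  obtain ⟨ω, rfl⟩ := S.σ.surjective ω
  rw [push_apply, R.op_of_notMem (fun h => hω ((R.mem_iff ω).2 h)), zero_apply]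

theorem norm_push_op_le {w : ∀ ω, S.B ω} {c : ℝ} (hc : ∀ ω, ‖w ω‖ ≤ c) (ω : Ω) :
    ‖S.push R.op w ω‖ ≤ R.K * c := by
  obtain ⟨ω, rfl⟩ := S.σ.surjective ω
  rw [push_apply]
  refine (ContinuousLinearMap.le_opNorm _ _).trans ?_
  gcongr
  · exact R.pos_K.le
  · exact R.norm_op_le ω
  · exact hc ω

variable [CompactSpace X] [BorelSpace X]

/-- The transfer operator on families. -/
def famOp : R.Fam →L[ℂ] R.Fam :=
  LinearMap.mkContinuous
    { toFun := fun w => R.ofFamily (S.push R.op fun ω => R.ev ω w)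
        (R.measurableVec_push_op (R.measurableVec_ev w)) (fun _ => R.push_op_of_notMem _) _
        (R.norm_push_op_le (R.norm_ev_le w))
      map_add' := fun w z => R.ext_ev_map fun ω _ => by
        simp only [ev_ofFamily, map_add, push_apply]
      map_smul' := fun c w => R.ext_ev_map fun ω _ => by
        simp only [ev_ofFamily, map_smul, RingHom.id_apply, push_apply] }
    R.K fun w => R.norm_le_of_ev (mul_nonneg R.pos_K.le (norm_nonneg _))
      (R.norm_push_op_le (R.norm_ev_le w))

theorem ev_famOp (w : R.Fam) (ω : Ω) : R.ev (S.σ ω) (R.famOp w) = R.op ω (R.ev ω w) :=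
  S.push_apply R.op (fun ω => R.ev ω w) ω

/-- The twisted transfer operator on families. -/
def famTwisted (θ : ℂ) : R.Fam →L[ℂ] R.Fam := R.famOp.comp (NormedSpace.exp (θ • R.famMul))

theorem ev_famTwisted (θ : ℂ) (w : R.Fam) (ω : Ω) :
    R.ev (S.σ ω) (R.famTwisted θ w) = R.twisted θ ω (R.ev ω w) := by
  have h := exp_intertwine (R.ev ω) (a := θ • R.famMul) (b := θ • Variation.mulCLM (R.f ω))
    (fun x => (R.ev ω).map_smul θ (R.famMul x)) w
  rw [famTwisted, ContinuousLinearMap.comp_apply, ev_famOp, h, twisted,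
    ContinuousLinearMap.comp_apply]

theorem famTwisted_zero : R.famTwisted 0 = R.famOp := by
  rw [famTwisted, zero_smul, NormedSpace.exp_zero]; rfl

theorem ev_famOp_pow (n : ℕ) (w : R.Fam) (ω : Ω) :
    R.ev (S.σ^[n] ω) ((R.famOp ^ n) w) =
      cocycleIter (σ := S.σ) (E := S.B) R.op n ω (R.ev ω w) := by
  induction n generalizing w ω with
  | zero => rfl
  | succ n ih =>
    have := ih (R.famOp w) (S.σ ω)
    rw [ev_famOp] at this
    rw [pow_succ]
    exact this

/-- Since `D` and `r` do not depend on the fiber, the fiberwise decay becomes decay in the sup norm.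
-/
theorem norm_famOp_pow_le {w : R.Fam} (hw : ∀ ω ∈ R.A, (S.V ω).intCLM (R.ev ω w) = 0) (n : ℕ) :
    ‖(R.famOp ^ n) w‖ ≤ R.D * R.r ^ n * ‖w‖ := by
  have hD := R.pos_D
  have hr := R.pos_r
  refine R.norm_le_of_ev (by positivity) fun ω => ?_
  by_cases hω : ω ∈ R.A
  · obtain ⟨ω, rfl⟩ := (S.σ.surjective.iterate n) ω
    have hω' : ω ∈ R.A := by
      revert hω
      induction n generalizing ω with
      | zero => exact id
      | succ n ih => exact fun h => (R.mem_iff ω).1 (ih (S.σ ω) h)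
    rw [ev_famOp_pow]
    refine (R.norm_iter_op_le hω' _ (hw ω hω') n).trans ?_
    gcongr
    exact R.norm_ev_le w ω
  · rw [R.ev_of_notMem _ hω, norm_zero]; positivity

end RandomSystem.RegularData

end

/-! ### The invariant family and the analytic branch of eigenvectors. -/

noncomputable section

namespace RandomSystem.RegularData

variable {Ω X : Type*} [MeasurableSpace Ω] {ℙ : Measure Ω} [MetricSpace X] [MeasurableSpace X]
  {S : RandomSystem Ω X ℙ} {F : S.𝒳 → ℝ} (R : S.RegularData F)

theorem forall_mem_of_map {p : Ω → Prop} (h : ∀ ω ∈ R.A, p (S.σ ω)) : ∀ ω ∈ R.A, p ω := by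
  intro ω hω
  obtain ⟨ω, rfl⟩ := S.σ.surjective ω
  exact h ω ((R.mem_iff ω).1 hω)

theorem exists_one_family : ∃ e : R.Fam, ∀ ω ∈ R.A, (R.ev ω e).val =ᵐ[S.m ω] fun _ => (1 : ℂ) := by
  choose e he he1 using fun ω => (S.V ω).exists_one
  have hm : S.MeasurableVec e := ⟨fun _ => 1, measurable_const, he⟩
  refine ⟨R.ofFamily (fun ω => R.A.indicator (fun _ => (1 : ℂ)) ω • e ω)
    (hm.smul (measurable_const.indicator R.measurableSet_A))
    (fun ω hω => by rw [Set.indicator_of_notMem hω, zero_smul]) 1 fun ω => ?_, fun ω hω => ?_⟩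
  · rw [norm_smul, he1, mul_one]
    by_cases hω : ω ∈ R.A <;> simp [hω]
  · rw [ev_ofFamily, Set.indicator_of_mem hω, one_smul]
    exact he ω

variable [CompactSpace X] [BorelSpace X]

theorem intCLM_famOp (w : R.Fam) {ω : Ω} (hω : ω ∈ R.A) :
    (S.V (S.σ ω)).intCLM (R.ev (S.σ ω) (R.famOp w)) = (S.V ω).intCLM (R.ev ω w) := by
  rw [ev_famOp, R.intCLM_op hω]

theorem nonneg_famOp {w : R.Fam} (hw : ∀ ω ∈ R.A, NonnegL1 (R.ev ω w).val) :
    ∀ ω ∈ R.A, NonnegL1 (R.ev ω (R.famOp w)).val :=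
  R.forall_mem_of_map fun ω hω => by
    rw [ev_famOp, R.op_val hω]
    exact transferL1_nonneg (S.measurable_fiberMap ω) (S.nonsingular ω) (L1.integrable_coeFn _)
      (hw ω hω)

/-- The equivariant density, as a family in `𝓑`. -/
theorem exists_invariant_family : ∃ v : R.Fam, R.famOp v = v ∧
    (∀ ω ∈ R.A, (S.V ω).intCLM (R.ev ω v) = 1) ∧ ∀ ω ∈ R.A, NonnegL1 (R.ev ω v).val := by
  obtain ⟨e, he⟩ := R.exists_one_family
  set w : ℕ → R.Fam := fun n => (R.famOp ^ n) e with hw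
  have hw0 : w 0 = e := rfl
  have hsucc : ∀ n, w (n + 1) = R.famOp (w n) := fun n => by
    simp only [hw, pow_succ']; rfl
  have hint : ∀ n, ∀ ω ∈ R.A, (S.V ω).intCLM (R.ev ω (w n)) = 1 := fun n => by
    induction n with
    | zero =>
      intro ω hω
      rw [hw0, Variation.intCLM_apply, integral_congr_ae (he ω hω)]
      simp
    | succ n ih =>
      exact R.forall_mem_of_map fun ω hω => by rw [hsucc, R.intCLM_famOp _ hω, ih ω hω]
  have hnn : ∀ n, ∀ ω ∈ R.A, NonnegL1 (R.ev ω (w n)).val := fun n => by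
    induction n with
    | zero => intro ω hω; rw [hw0]; exact (he ω hω).mono fun x hx => by rw [hx]; simp
    | succ n ih => rw [hsucc]; exact R.nonneg_famOp ih
  -- Consecutive iterates differ by `L^n (e - L e)`, and `e - L e` has zero integral over each fiber
  -- in `A`.
  have hdist : ∀ n, dist (w n) (w (n + 1)) ≤ (R.D * ‖e - R.famOp e‖) * R.r ^ n := fun n => by
    have h1 : w n - w (n + 1) = (R.famOp ^ n) (e - R.famOp e) := by
      rw [map_sub]; simp only [hw, pow_succ]; rfl
    rw [dist_eq_norm, h1]
    refine (R.norm_famOp_pow_le (R.forall_mem_of_map fun ω hω => ?_) n).trans_eq (by ring)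
    have h0 := hint 0 (S.σ ω) ((R.mem_iff ω).2 hω)
    have h1 := hint 1 (S.σ ω) ((R.mem_iff ω).2 hω)
    simp only [hw, pow_zero, pow_one] at h0 h1
    rw [map_sub, map_sub, h1]
    exact sub_eq_zero.2 h0
  obtain ⟨v, hv⟩ := cauchySeq_tendsto_of_complete (cauchySeq_of_le_geometric _ _ R.r_lt_one hdist)
  have hev : ∀ ω, Tendsto (fun n => R.ev ω (w n)) atTop (𝓝 (R.ev ω v)) := fun ω =>
    ((R.ev ω).continuous.tendsto v).comp hv
  refine ⟨v, ?_, fun ω hω => ?_, fun ω hω => ?_⟩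
  · have h1 := (R.famOp.continuous.tendsto v).comp hv
    refine tendsto_nhds_unique h1 ?_
    have h2 := hv.comp (tendsto_add_atTop_nat 1)
    exact h2.congr hsucc
  · have h1 := ((S.V ω).intCLM.continuous.tendsto _).comp (hev ω)
    exact tendsto_nhds_unique h1 (tendsto_const_nhds.congr fun n => (hint n ω hω).symm)
  · filter_upwards [Variation.Space.ae_tendsto (hev ω), ae_all_iff.2 fun n => hnn n ω hω]
      with x h1 h2
    refine ⟨tendsto_nhds_unique ((Complex.continuous_im.tendsto _).comp h1)
      (tendsto_const_nhds.congr fun n => (h2 n).1.symm), ?_⟩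
    exact ge_of_tendsto' ((Complex.continuous_re.tendsto _).comp h1) fun n => (h2 n).2

variable {R} in
-- Subtracting `(∫ L w) v` removes the integral, so `N` maps into the families of zero integral,
-- where it agrees with `L`. Hence `N^(n+1) = L^n N`, which decays; the shift in the exponent
-- accounts for the division by `r` in the constant.
theorem isUnit_one_sub {v : R.Fam} (hv1 : ∀ ω ∈ R.A, (S.V ω).intCLM (R.ev ω v) = 1) :
    IsUnit (1 - (R.famOp - (R.intSMul.flip v).comp R.famOp)) := by
  set N := R.famOp - (R.intSMul.flip v).comp R.famOp with hN
  have hNapp : ∀ w, N w = R.famOp w - R.intSMul (R.famOp w) v := fun w => rfl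
  have hZN : ∀ w, ∀ ω ∈ R.A, (S.V ω).intCLM (R.ev ω (N w)) = 0 := fun w ω hω => by
    rw [hNapp, map_sub, map_sub, ev_intSMul, map_smul, hv1 ω hω, smul_eq_mul, mul_one, sub_self]
  have hpow : ∀ n (w : R.Fam), (∀ ω ∈ R.A, (S.V ω).intCLM (R.ev ω w) = 0) →
      (N ^ n) w = (R.famOp ^ n) w := fun n => by
    induction n with
    | zero => intro w _; rfl
    | succ n ih =>
      intro w hw
      have hw' : ∀ ω ∈ R.A, (S.V ω).intCLM (R.ev ω (R.famOp w)) = 0 :=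
        R.forall_mem_of_map fun ω hω => by rw [R.intCLM_famOp w hω, hw ω hω]
      have h1 : N w = R.famOp w := by
        refine R.ext_ev fun ω hω => ?_
        rw [hNapp, map_sub, ev_intSMul, hw' ω hω, zero_smul, sub_zero]
      rw [pow_succ, pow_succ]
      exact (congrArg (N ^ n) h1).trans (ih _ hw')
  have hD := R.pos_D
  have hr := R.pos_r
  refine isUnit_one_sub_of_norm_pow_le (C := R.D * ‖N‖ / R.r) R.pos_r.le R.r_lt_one fun n hn => ?_
  obtain ⟨n, rfl⟩ := Nat.exists_eq_succ_of_ne_zero (Nat.one_le_iff_ne_zero.1 hn)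
  refine ContinuousLinearMap.opNorm_le_bound _ (by positivity) fun w => ?_
  have h1 : (N ^ n.succ) w = (R.famOp ^ n) (N w) := by
    rw [Nat.succ_eq_add_one, pow_succ, ← hpow n _ (hZN w)]; rfl
  rw [h1]
  refine (R.norm_famOp_pow_le (hZN w) n).trans ?_
  calc R.D * R.r ^ n * ‖N w‖ ≤ R.D * R.r ^ n * (‖N‖ * ‖w‖) := by
        gcongr; exact N.le_opNorm w
    _ = _ := by rw [Nat.succ_eq_add_one, pow_succ]; field_simp

/-- An analytic family of eigenvectors of the twisted operators on families, with the uniform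
bounds that yield a spectral gap. -/
structure Eigenfamily (v : R.Fam) (u : ℂ → R.Fam) (U : Set ℂ) (δ C : ℝ) : Prop where
  invariant : R.famOp v = v
  integral_eq_one : ∀ ω ∈ R.A, (S.V ω).intCLM (R.ev ω v) = 1
  isOpen : IsOpen U
  zero_mem : 0 ∈ U
  at_zero : u 0 = v
  differentiableOn : DifferentiableOn ℂ u U
  eigen : ∀ θ ∈ U, R.famTwisted θ (u θ) = R.intSMul (R.famTwisted θ (u θ)) (u θ)
  norm_le : ∀ θ ∈ U, ‖u θ‖ ≤ C
  norm_sub_le : ∀ θ ∈ U, ‖R.famTwisted θ (u θ) - v‖ ≤ δ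
  twist_le : ∀ θ ∈ U, R.K * (Real.exp (‖θ‖ * R.b) - 1) ≤ δ
  pos_δ : 0 < δ
  δ_le : δ ≤ 1 / 2
  nonneg_C : 0 ≤ C
  gap : (1 + δ) * (R.r + R.D * ((1 + C) * (2 * δ * (1 + R.K)))) < 1

theorem differentiable_famTwisted : Differentiable ℂ R.famTwisted := by
  refine (differentiable_const _).clm_comp fun θ => ?_
  exact (NormedSpace.exp_analytic (𝕂 := ℂ) (θ • R.famMul)).differentiableAt.comp θ
    (differentiableAt_id.smul_const _)

theorem exists_eigenfamily {v : R.Fam} (hv : R.famOp v = v)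
    (hv1 : ∀ ω ∈ R.A, (S.V ω).intCLM (R.ev ω v) = 1) :
    ∃ u U δ C, R.Eigenfamily v u U δ C := by
  obtain ⟨u, hu0, hua, hue⟩ := exists_analytic_eigenvector
    (R.differentiable_famTwisted.analyticAt 0) R.intSMul (v := v) (by rw [famTwisted_zero, hv])
    (fun w => R.ext_ev fun ω hω => by rw [ev_intSMul, hv1 ω hω, one_smul])
    (by rw [famTwisted_zero]; exact isUnit_one_sub hv1)
  set C := ‖v‖ + 1 with hC
  -- `δ` is chosen after `C` and before the radius in `θ`. It bounds `|λ - 1|` and `‖L^θ - L‖`; `δ ≤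
  -- 1/2` gives `|λ|⁻¹ ≤ 2`, so `2 δ (1 + K)` bounds `‖M - L‖`. The factor `1 + δ` pays for undoing
  -- the normalization by `λ`, and at `δ = 0` the expression is `r < 1`.
  obtain ⟨δ, ⟨hδ1, hδ2⟩, hδ0⟩ : ∃ δ : ℝ, (δ ≤ 1 / 2 ∧
      (1 + δ) * (R.r + R.D * ((1 + C) * (2 * δ * (1 + R.K)))) < 1) ∧ 0 < δ := by
    have hcont : Continuous fun δ : ℝ =>
        (1 + δ) * (R.r + R.D * ((1 + C) * (2 * δ * (1 + R.K)))) := by fun_prop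
    have h1 : ∀ᶠ δ : ℝ in 𝓝 0, (1 + δ) * (R.r + R.D * ((1 + C) * (2 * δ * (1 + R.K)))) < 1 :=
      (hcont.tendsto 0).eventually_lt_const (by simpa using R.r_lt_one)
    have h2 : ∀ᶠ δ : ℝ in 𝓝 0, δ ≤ 1 / 2 := eventually_le_nhds (by norm_num)
    exact (((h2.and h1).filter_mono nhdsWithin_le_nhds).and
      (self_mem_nhdsWithin (s := Set.Ioi (0 : ℝ)))).exists
  have huc : ContinuousAt u 0 := hua.continuousAt
  have e1 : ∀ᶠ θ in 𝓝 (0 : ℂ), ‖u θ‖ ≤ C := by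
    have : Tendsto (fun θ => ‖u θ‖) (𝓝 0) (𝓝 ‖v‖) := by simpa [hu0] using huc.norm.tendsto
    exact (this.eventually_lt_const (by simp [hC])).mono fun _ h => h.le
  have e2 : ∀ᶠ θ in 𝓝 (0 : ℂ), ‖R.famTwisted θ (u θ) - v‖ ≤ δ := by
    have h1 : ContinuousAt (fun θ => ‖R.famTwisted θ (u θ) - v‖) 0 :=
      ((R.differentiable_famTwisted.continuous.continuousAt.clm_apply huc).sub
        continuousAt_const).norm
    refine (h1.tendsto.eventually_lt_const ?_).mono fun _ h => h.le
    rw [hu0, famTwisted_zero, hv, sub_self, norm_zero]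
    exact hδ0
  have e3 : ∀ᶠ θ in 𝓝 (0 : ℂ), R.K * (Real.exp (‖θ‖ * R.b) - 1) ≤ δ := by
    have h1 : Continuous fun θ : ℂ => R.K * (Real.exp (‖θ‖ * R.b) - 1) := by fun_prop
    exact ((h1.tendsto 0).eventually_lt_const (by simpa using hδ0)).mono fun _ h => h.le
  obtain ⟨ρ, hρ, hball⟩ := Metric.eventually_nhds_iff_ball.1
    (hua.eventually_analyticAt.and (hue.and (e1.and (e2.and e3))))
  exact ⟨u, Metric.ball 0 ρ, δ, C, {
    invariant := hv
    integral_eq_one := hv1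
    isOpen := Metric.isOpen_ball
    zero_mem := Metric.mem_ball_self hρ
    at_zero := hu0
    differentiableOn := fun θ hθ => (hball θ hθ).1.differentiableAt.differentiableWithinAt
    eigen := fun θ hθ => (hball θ hθ).2.1
    norm_le := fun θ hθ => (hball θ hθ).2.2.1
    norm_sub_le := fun θ hθ => (hball θ hθ).2.2.2.1
    twist_le := fun θ hθ => (hball θ hθ).2.2.2.2
    pos_δ := hδ0
    δ_le := hδ1
    nonneg_C := by positivity
    gap := hδ2 }⟩

end RandomSystem.RegularData

end

/-! ### Eigenvalues, dual eigenfunctionals and the spectral gap. -/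

noncomputable section

namespace RandomSystem.RegularData

variable {Ω X : Type*} [MeasurableSpace Ω] {ℙ : Measure Ω} [MetricSpace X] [MeasurableSpace X]
  [CompactSpace X] [BorelSpace X] {S : RandomSystem Ω X ℙ} {F : S.𝒳 → ℝ} (R : S.RegularData F)

/-- The eigenvalue `∫ L_ω^θ u_ω^θ`. -/
def eigenvalue (u : ℂ → R.Fam) (θ : ℂ) (ω : Ω) : ℂ :=
  (S.V (S.σ ω)).intCLM (R.ev (S.σ ω) (R.famTwisted θ (u θ)))

/-- The twisted operators, normalized by the eigenvalues. -/
def normalized (u : ℂ → R.Fam) (θ : ℂ) (ω : Ω) : S.B ω →L[ℂ] S.B (S.σ ω) :=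
  (R.eigenvalue u θ ω)⁻¹ • R.twisted θ ω

/-- The functionals `∫ ∘ M^n` for the normalized operators `M`. -/
def approxFunctional (u : ℂ → R.Fam) (θ : ℂ) (n : ℕ) (ω : Ω) : S.B ω →L[ℂ] ℂ :=
  NormalizedCocycle.functional (σ := S.σ) (E := S.B) (fun ω => (S.V ω).intCLM)
    (R.normalized u θ) n ω

/-- The dual eigenfunctional. -/
def eigenfunctional (u : ℂ → R.Fam) (θ : ℂ) (ω : Ω) : S.B ω →L[ℂ] ℂ :=
  limUnder atTop fun n => R.approxFunctional u θ n ω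

theorem measurable_eigenvalue (u : ℂ → R.Fam) (θ : ℂ) : Measurable (R.eigenvalue u θ) :=
  (R.measurableVec_ev (R.famTwisted θ (u θ))).measurable_integral.comp S.σ.measurable

theorem approxFunctional_succ (u : ℂ → R.Fam) (θ : ℂ) (n : ℕ) (ω : Ω) :
    R.approxFunctional u θ (n + 1) ω =
      (R.approxFunctional u θ n (S.σ ω)).comp (R.normalized u θ ω) := rfl

theorem normalized_of_notMem (u : ℂ → R.Fam) (θ : ℂ) {ω : Ω} (hω : ω ∉ R.A) :
    R.normalized u θ ω = 0 := by
  rw [normalized, R.twisted_of_notMem θ hω, smul_zero]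

/-- The functional of order `n + 1` on `γ` is `λ_ω⁻¹` times the one of order `n` at `σω` on the
pushed family, which is again measurable; hence the induction over all `γ`. -/
theorem measurable_approxFunctional (u : ℂ → R.Fam) (θ : ℂ) (n : ℕ) {γ : ∀ ω, S.B ω}
    (hγ : S.MeasurableVec γ) : Measurable fun ω => R.approxFunctional u θ n ω (γ ω) := by
  induction n generalizing γ with
  | zero => exact hγ.measurable_integral
  | succ n ih =>
    have h1 := (ih (R.measurableVec_push_twisted hγ θ)).comp S.σ.measurable
    have h2 := (R.measurable_eigenvalue u θ).inv.mul h1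
    refine (congrArg Measurable (funext fun ω => ?_)).mp h2
    rw [approxFunctional_succ, normalized, ContinuousLinearMap.comp_apply, smul_apply, map_smul,
      smul_eq_mul, Pi.mul_apply, Function.comp_apply, push_apply, Pi.inv_apply]

namespace Eigenfamily

variable {R} {v : R.Fam} {u : ℂ → R.Fam} {U : Set ℂ} {δ C : ℝ}

theorem norm_eigenvalue_sub_one_le (H : R.Eigenfamily v u U δ C)
    {θ : ℂ} (hθ : θ ∈ U) {ω : Ω} (hω : ω ∈ R.A) :
    ‖R.eigenvalue u θ ω - 1‖ ≤ δ := by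
  rw [eigenvalue, ← H.integral_eq_one (S.σ ω) ((R.mem_iff ω).2 hω), ← map_sub, ← map_sub]
  exact (Variation.norm_intCLM_apply_le _).trans ((R.norm_ev_le _ _).trans (H.norm_sub_le θ hθ))

theorem half_le_norm_eigenvalue (H : R.Eigenfamily v u U δ C)
    {θ : ℂ} (hθ : θ ∈ U) {ω : Ω} (hω : ω ∈ R.A) :
    1 / 2 ≤ ‖R.eigenvalue u θ ω‖ := by
  have h1 := H.norm_eigenvalue_sub_one_le hθ hω
  have h2 := norm_sub_norm_le (1 : ℂ) (R.eigenvalue u θ ω)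
  rw [norm_sub_rev, norm_one] at h2
  linarith [H.δ_le]

theorem eigenvalue_ne_zero (H : R.Eigenfamily v u U δ C)
    {θ : ℂ} (hθ : θ ∈ U) {ω : Ω} (hω : ω ∈ R.A) :
    R.eigenvalue u θ ω ≠ 0 := by
  rw [← norm_pos_iff]; linarith [H.half_le_norm_eigenvalue hθ hω]

theorem norm_eigenvalue_le (H : R.Eigenfamily v u U δ C)
    {θ : ℂ} (hθ : θ ∈ U) {ω : Ω} (hω : ω ∈ R.A) :
    ‖R.eigenvalue u θ ω‖ ≤ 1 + δ := by
  have h1 := H.norm_eigenvalue_sub_one_le hθ hω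
  have h2 := norm_sub_norm_le (R.eigenvalue u θ ω) (1 : ℂ)
  rw [norm_one] at h2
  linarith

theorem twisted_apply (H : R.Eigenfamily v u U δ C) {θ : ℂ} (hθ : θ ∈ U) (ω : Ω) :
    R.twisted θ ω (R.ev ω (u θ)) = R.eigenvalue u θ ω • R.ev (S.σ ω) (u θ) := by
  have h1 := congrArg (R.ev (S.σ ω)) (H.eigen θ hθ)
  rw [ev_intSMul] at h1
  rw [← ev_famTwisted, h1]
  rfl

/-- The normalization is not imposed on the branch: integrating the eigenvector equation gives `λ =
λ ∫ u`, and `λ ≠ 0`. -/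
theorem integral_eigenvector (H : R.Eigenfamily v u U δ C) {θ : ℂ} (hθ : θ ∈ U) :
    ∀ ω ∈ R.A, (S.V ω).intCLM (R.ev ω (u θ)) = 1 :=
  R.forall_mem_of_map fun ω hω => by
    have h1 := congrArg (S.V (S.σ ω)).intCLM (H.twisted_apply hθ ω)
    rw [map_smul, ← ev_famTwisted, smul_eq_mul] at h1
    change R.eigenvalue u θ ω = _ at h1
    exact (mul_eq_left₀ (H.eigenvalue_ne_zero hθ hω)).1 h1.symm

theorem normalizedCocycle (H : R.Eigenfamily v u U δ C) {θ : ℂ} (hθ : θ ∈ U) :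
    NormalizedCocycle S.σ S.B R.A (fun ω => (S.V ω).intCLM) R.op (R.normalized u θ)
      (fun ω => R.ev ω (u θ)) R.D R.r (2 * δ * (1 + R.K)) C where
  mapsTo ω hω := (R.mem_iff ω).2 hω
  norm_functional_le ω h := Variation.norm_intCLM_apply_le h
  functional_map ω hω h := R.intCLM_op hω h
  decay ω hω h h0 n := R.norm_iter_op_le hω h h0 n
  map_vec ω hω := by
    rw [normalized, smul_apply, H.twisted_apply hθ, smul_smul,
      inv_mul_cancel₀ (H.eigenvalue_ne_zero hθ hω), one_smul]
  functional_vec ω hω := H.integral_eigenvector hθ ω hω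
  norm_vec_le ω _ := (R.norm_ev_le _ ω).trans (H.norm_le θ hθ)
  norm_sub_le ω hω h := by
    set l := R.eigenvalue u θ ω with hl
    have hl0 : l ≠ 0 := H.eigenvalue_ne_zero hθ hω
    -- `M - L = λ⁻¹ ((L^θ - L) + (1 - λ) L)`, whose factors are bounded by `2`, `δ` and `δ K`.
    have h1 : R.normalized u θ ω h - R.op ω h =
        l⁻¹ • ((R.twisted θ ω - R.op ω) h + (1 - l) • R.op ω h) := by
      rw [normalized, smul_apply, sub_apply, ← hl, sub_smul, one_smul, smul_add, smul_sub, smul_sub,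
        smul_smul, inv_mul_cancel₀ hl0, one_smul]
      abel
    have h2 : ‖l⁻¹‖ ≤ 2 := by
      rw [norm_inv]
      refine inv_le_of_inv_le₀ (by norm_num) ?_
      have := H.half_le_norm_eigenvalue hθ hω
      rw [one_div] at this
      exact this
    have h3 : ‖(R.twisted θ ω - R.op ω) h‖ ≤ δ * ‖h‖ :=
      (ContinuousLinearMap.le_opNorm _ h).trans
        (mul_le_mul_of_nonneg_right ((R.norm_twisted_sub_le θ ω).trans (H.twist_le θ hθ))
          (norm_nonneg _))
    have h4 : ‖(1 - l) • R.op ω h‖ ≤ δ * (R.K * ‖h‖) := by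
      rw [norm_smul, norm_sub_rev]
      exact mul_le_mul (H.norm_eigenvalue_sub_one_le hθ hω)
        ((ContinuousLinearMap.le_opNorm _ h).trans
          (mul_le_mul_of_nonneg_right (R.norm_op_le ω) (norm_nonneg _)))
        (norm_nonneg _) H.pos_δ.le
    rw [h1, norm_smul]
    calc _ ≤ 2 * (δ * ‖h‖ + δ * (R.K * ‖h‖)) :=
          mul_le_mul h2 ((norm_add_le _ _).trans (add_le_add h3 h4)) (norm_nonneg _) (by norm_num)
      _ = _ := by ring
  pos_D := R.pos_D
  pos_r := R.pos_r
  nonneg_ε := mul_nonneg (mul_nonneg zero_le_two H.pos_δ.le) (by linarith [R.pos_K])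
  nonneg_C := H.nonneg_C

theorem rate_nonneg (H : R.Eigenfamily v u U δ C)
    : 0 < R.r + R.D * ((1 + C) * (2 * δ * (1 + R.K))) := by
  have := R.pos_r
  have := R.pos_D
  have := R.pos_K
  have := H.nonneg_C
  have := H.pos_δ
  positivity

theorem rate_lt_one (H : R.Eigenfamily v u U δ C)
    : R.r + R.D * ((1 + C) * (2 * δ * (1 + R.K))) < 1 := by
  nlinarith [H.gap, H.rate_nonneg, H.pos_δ]

theorem tendsto_eigenfunctional (H : R.Eigenfamily v u U δ C) {θ : ℂ} (hθ : θ ∈ U) (ω : Ω) :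
    Tendsto (fun n => R.approxFunctional u θ n ω) atTop (𝓝 (R.eigenfunctional u θ ω)) := by
  refine tendsto_nhds_limUnder ?_
  by_cases hω : ω ∈ R.A
  · obtain ⟨φ, hφ, -⟩ := (H.normalizedCocycle hθ).exists_limit H.rate_lt_one hω
    exact ⟨φ, hφ⟩
  -- Off `A` all terms but the zeroth vanish. Convergence at every `ω` is what makes the limit
  -- measurable on all of `Ω`.
  · refine ⟨0, (tendsto_add_atTop_iff_nat 1).1 (tendsto_const_nhds.congr fun n => ?_)⟩
    rw [approxFunctional_succ, R.normalized_of_notMem u θ hω, ContinuousLinearMap.comp_zero]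

theorem norm_approxFunctional_sub_le (H : R.Eigenfamily v u U δ C)
    {θ : ℂ} (hθ : θ ∈ U) {ω : Ω} (hω : ω ∈ R.A) (n : ℕ) :
    ‖R.approxFunctional u θ n ω - R.eigenfunctional u θ ω‖ ≤
      ((2 * δ * (1 + R.K)) * R.D * (1 + C)) /
        (1 - (R.r + R.D * ((1 + C) * (2 * δ * (1 + R.K))))) *
          (R.r + R.D * ((1 + C) * (2 * δ * (1 + R.K)))) ^ n := by
  obtain ⟨φ, hφ, hb⟩ := (H.normalizedCocycle hθ).exists_limit H.rate_lt_one hω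
  rw [tendsto_nhds_unique (H.tendsto_eigenfunctional hθ ω) hφ]
  exact hb n

theorem measurableDual (H : R.Eigenfamily v u U δ C)
    {θ : ℂ} (hθ : θ ∈ U) : S.MeasurableDual (R.eigenfunctional u θ) := by
  intro g γ hg hγ
  refine measurable_of_tendsto_metrizable
    (fun n => R.measurable_approxFunctional u θ n ⟨g, hg, hγ⟩) ?_
  rw [tendsto_pi_nhds]
  intro ω
  exact ((ContinuousLinearMap.apply ℂ ℂ (γ ω)).continuous.tendsto _).comp
    (H.tendsto_eigenfunctional hθ ω)

/-- Composing `∫ ∘ M^n` at `σω` with `M_ω` gives `∫ ∘ M^(n+1)` at `ω`; passing to the limit gives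
invariance under `M`, and `L^θ = λ M`. -/
theorem eigenfunctional_comp (H : R.Eigenfamily v u U δ C)
    {θ : ℂ} (hθ : θ ∈ U) {ω : Ω} (hω : ω ∈ R.A) :
    (R.eigenfunctional u θ (S.σ ω)).comp (R.twisted θ ω) =
      R.eigenvalue u θ ω • R.eigenfunctional u θ ω := by
  have h1 : (R.eigenfunctional u θ (S.σ ω)).comp (R.normalized u θ ω) =
      R.eigenfunctional u θ ω := by
    refine tendsto_nhds_unique ?_ ((H.tendsto_eigenfunctional hθ ω).comp (tendsto_add_atTop_nat 1))
    exact (((ContinuousLinearMap.compL ℂ _ _ ℂ).flip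
      (R.normalized u θ ω)).continuous.tendsto _).comp (H.tendsto_eigenfunctional hθ (S.σ ω))
  have h2 : R.twisted θ ω = R.eigenvalue u θ ω • R.normalized u θ ω := by
    rw [normalized, smul_smul, mul_inv_cancel₀ (H.eigenvalue_ne_zero hθ hω), one_smul]
  rw [h2, ContinuousLinearMap.comp_smul, h1]

theorem eigenfunctional_eigenvector (H : R.Eigenfamily v u U δ C)
    {θ : ℂ} (hθ : θ ∈ U) {ω : Ω} (hω : ω ∈ R.A) :
    R.eigenfunctional u θ ω (R.ev ω (u θ)) = 1 := by
  have h1 := ((ContinuousLinearMap.apply ℂ ℂ (R.ev ω (u θ))).continuous.tendsto _).comp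
    (H.tendsto_eigenfunctional hθ ω)
  refine tendsto_nhds_unique h1 (tendsto_const_nhds.congr fun n => ?_)
  exact ((H.normalizedCocycle hθ).functional_apply_vec n ω hω).symm

theorem norm_eigenfunctional_le (H : R.Eigenfamily v u U δ C)
    {θ : ℂ} (hθ : θ ∈ U) {ω : Ω} (hω : ω ∈ R.A) :
    ‖R.eigenfunctional u θ ω‖ ≤ 1 + ((2 * δ * (1 + R.K)) * R.D * (1 + C)) /
        (1 - (R.r + R.D * ((1 + C) * (2 * δ * (1 + R.K))))) := by
  have h1 := H.norm_approxFunctional_sub_le hθ hω 0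
  rw [pow_zero, mul_one] at h1
  have h2 : ‖R.approxFunctional u θ 0 ω‖ ≤ 1 :=
    ContinuousLinearMap.opNorm_le_bound _ zero_le_one fun h => by
      rw [one_mul]; exact Variation.norm_intCLM_apply_le h
  have h3 : R.eigenfunctional u θ ω = R.approxFunctional u θ 0 ω -
    (R.approxFunctional u θ 0 ω - R.eigenfunctional u θ ω) := by abel
  rw [h3]
  exact (_root_.norm_sub_le _ _).trans (add_le_add h2 h1)

theorem eigenvalue_zero (H : R.Eigenfamily v u U δ C)
    {ω : Ω} (hω : ω ∈ R.A) : R.eigenvalue u 0 ω = 1 := by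
  rw [eigenvalue, H.at_zero, famTwisted_zero, H.invariant,
    H.integral_eq_one _ ((R.mem_iff ω).2 hω)]

theorem eigenfunctional_zero (H : R.Eigenfamily v u U δ C) {ω : Ω} (hω : ω ∈ R.A) :
    R.eigenfunctional u 0 ω = (S.V ω).intCLM := by
  have h1 : ∀ n, ∀ ω ∈ R.A, R.approxFunctional u 0 n ω = (S.V ω).intCLM := fun n => by
    induction n with
    | zero => intro ω _; rfl
    | succ n ih =>
      intro ω hω
      rw [approxFunctional_succ, ih _ ((R.mem_iff ω).2 hω), normalized, H.eigenvalue_zero hω,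
        inv_one, one_smul, twisted_zero]
      exact ContinuousLinearMap.ext fun h => R.intCLM_op hω h
  exact tendsto_nhds_unique (H.tendsto_eigenfunctional H.zero_mem ω)
    (tendsto_const_nhds.congr fun n => (h1 n ω hω).symm)

theorem differentiableOn_eigenvalue (H : R.Eigenfamily v u U δ C) (ω : Ω) :
    DifferentiableOn ℂ (fun θ => R.eigenvalue u θ ω) U := by
  have h1 : DifferentiableOn ℂ (fun θ => R.famTwisted θ (u θ)) U :=
    R.differentiable_famTwisted.differentiableOn.clm_apply H.differentiableOn
  exact ((S.V (S.σ ω)).intCLM.comp (R.ev (S.σ ω))).differentiable.comp_differentiableOn h1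

theorem differentiableOn_eigenvector (H : R.Eigenfamily v u U δ C)
    (ω : Ω) : DifferentiableOn ℂ (fun θ => R.ev ω (u θ)) U :=
  (R.ev ω).differentiable.comp_differentiableOn H.differentiableOn

/-- The approximating functionals are holomorphic and converge uniformly on the open set `U`,
because the geometric error bound does not involve `θ`. -/
theorem differentiableOn_eigenfunctional (H : R.Eigenfamily v u U δ C) {ω : Ω} (hω : ω ∈ R.A) :
    DifferentiableOn ℂ (fun θ => R.eigenfunctional u θ ω) U := by
  have h1 : ∀ ω ∈ R.A, DifferentiableOn ℂ (fun θ => R.normalized u θ ω) U := fun ω hω =>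
    ((H.differentiableOn_eigenvalue ω).inv fun θ hθ => H.eigenvalue_ne_zero hθ hω).smul
      (R.differentiable_twisted ω).differentiableOn
  have h2 : ∀ n, DifferentiableOn ℂ (fun θ => R.approxFunctional u θ n ω) U := fun n =>
    (differentiableOn_const (S.V (S.σ^[n] ω)).intCLM).clm_comp
      (differentiableOn_cocycleIter (σ := S.σ) (E := S.B) (J := R.A)
        (fun ω hω => (R.mem_iff ω).2 hω) h1 n ω hω)
  have h3 : TendstoUniformlyOn (fun n θ => R.approxFunctional u θ n ω)
      (fun θ => R.eigenfunctional u θ ω) atTop U := by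
    rw [Metric.tendstoUniformlyOn_iff]
    intro ε hε
    have h4 := (tendsto_pow_atTop_nhds_zero_of_lt_one H.rate_nonneg.le H.rate_lt_one).const_mul
      (((2 * δ * (1 + R.K)) * R.D * (1 + C)) /
        (1 - (R.r + R.D * ((1 + C) * (2 * δ * (1 + R.K))))))
    rw [mul_zero] at h4
    filter_upwards [h4.eventually_lt_const hε] with n hn θ hθ
    rw [dist_comm, dist_eq_norm]
    exact (H.norm_approxFunctional_sub_le hθ hω n).trans_lt hn
  exact h3.tendstoLocallyUniformlyOn.differentiableOn (Eventually.of_forall h2) H.isOpen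

/-- The gap of `M` is multiplied by the product of the eigenvalues, of modulus at most `(1 + δ)^n`;
the condition `gap` keeps the resulting rate below `1`. -/
theorem norm_iterOp_sub_le (H : R.Eigenfamily v u U δ C)
    : ∃ c r : ℝ, 0 < c ∧ 0 < r ∧ r < 1 ∧ ∀ ω ∈ R.A, ∀ n : ℕ, ∀ h : S.B ω,
    ∀ θ ∈ U, ‖S.iterOp (R.twisted θ) n ω h -
      ((∏ i ∈ Finset.range n, R.eigenvalue u θ (S.σ^[i] ω)) * R.eigenfunctional u θ ω h) •
        R.ev (S.σ^[n] ω) (u θ)‖ ≤ c * r ^ n * ‖h‖ := by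
  set x := R.r + R.D * ((1 + C) * (2 * δ * (1 + R.K))) with hx
  have hx0 : 0 < x := H.rate_nonneg
  have hx1 : 0 < 1 - x := sub_pos.2 H.rate_lt_one
  have hδ := H.pos_δ
  have hC := H.nonneg_C
  have hD := R.pos_D
  have hK := R.pos_K
  refine ⟨R.D * (1 + C) + ((2 * δ * (1 + R.K)) * R.D * (1 + C)) / (1 - x) * C, (1 + δ) * x,
    by positivity, by positivity, H.gap, fun ω hω n h θ hθ => ?_⟩
  have h1 : R.twisted θ = fun ω => R.eigenvalue u θ ω • R.normalized u θ ω := by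
    funext ω
    by_cases hω : ω ∈ R.A
    · rw [normalized, smul_smul, mul_inv_cancel₀ (H.eigenvalue_ne_zero hθ hω), one_smul]
    · rw [R.normalized_of_notMem u θ hω, smul_zero, R.twisted_of_notMem θ hω]
  have h2 := cocycleIter_smul (σ := S.σ) (E := S.B) (R.normalized u θ) (R.eigenvalue u θ) n ω
  rw [iterOp_eq_cocycleIter, h1, h2, smul_apply, mul_smul, ← smul_sub, norm_smul]
  have h3 := (H.normalizedCocycle hθ).norm_iter_sub_le H.rate_lt_one hω
    (H.tendsto_eigenfunctional hθ ω) n h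
  have h4 : ‖∏ i ∈ Finset.range n, R.eigenvalue u θ (S.σ^[i] ω)‖ ≤ (1 + δ) ^ n := by
    rw [norm_prod]
    refine (Finset.prod_le_prod (fun _ _ => norm_nonneg _) fun i _ =>
      H.norm_eigenvalue_le hθ (R.iterate_mem i ω hω)).trans_eq ?_
    simp
  refine (mul_le_mul h4 h3 (norm_nonneg _) (by positivity)).trans_eq ?_
  rw [mul_pow]
  ring

end Eigenfamily

end RandomSystem.RegularData

end

/-! ### Removal of null sets and the equivariant density as a function. -/

noncomputable section

/-- Keep the points whose whole two-sided orbit avoids a measurable null set containing the bad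
points. -/
theorem exists_invariant_measurable_set {Ω : Type*} [MeasurableSpace Ω] {ℙ : Measure Ω}
    (σ : Ω ≃ᵐ Ω) (hσ : MeasurePreserving σ ℙ ℙ) {p : Ω → Prop} (h : ∀ᵐ ω ∂ℙ, p ω) :
    ∃ A : Set Ω, MeasurableSet A ∧ (∀ ω, σ ω ∈ A ↔ ω ∈ A) ∧ (∀ᵐ ω ∂ℙ, ω ∈ A) ∧ ∀ ω ∈ A, p ω := by
  obtain ⟨s, hs, hsm, hs0⟩ := exists_measurable_superset_of_null h
  have hσ' : MeasurePreserving σ.symm ℙ ℙ := hσ.symm σ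
  refine ⟨⋂ n : ℕ, (σ^[n]) ⁻¹' sᶜ ∩ (σ.symm^[n]) ⁻¹' sᶜ, ?_, fun ω => ?_, ?_, fun ω hω => ?_⟩
  · exact MeasurableSet.iInter fun n => ((σ.measurable.iterate n) hsm.compl).inter
      ((σ.symm.measurable.iterate n) hsm.compl)
  · simp only [Set.mem_iInter, Set.mem_inter_iff, Set.mem_preimage]
    constructor
    · intro h n
      refine ⟨?_, ?_⟩
      · cases n with
        | zero => simpa using (h 1).2
        | succ n => exact (h n).1
      · simpa using (h (n + 1)).2
    · intro h n
      refine ⟨(h (n + 1)).1, ?_⟩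
      cases n with
      | zero => exact (h 1).1
      | succ n => simpa using (h n).2
  · have hsc : ∀ᵐ ω ∂ℙ, ω ∈ sᶜ := measure_eq_zero_iff_ae_notMem.1 hs0
    have h1 : ∀ᵐ ω ∂ℙ, ∀ n : ℕ, σ^[n] ω ∈ sᶜ := ae_all_iff.2 fun n =>
      (hσ.iterate n).quasiMeasurePreserving.ae hsc
    have h2 : ∀ᵐ ω ∂ℙ, ∀ n : ℕ, σ.symm^[n] ω ∈ sᶜ := ae_all_iff.2 fun n =>
      (hσ'.iterate n).quasiMeasurePreserving.ae hsc
    filter_upwards [h1, h2] with ω h1 h2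
    exact Set.mem_iInter.2 fun n => ⟨h1 n, h2 n⟩
  · by_contra hp
    exact (Set.mem_iInter.1 hω 0).1 (hs hp)

namespace RandomSystem

variable {Ω X : Type*} [MeasurableSpace Ω] {ℙ : Measure Ω} [MetricSpace X] [MeasurableSpace X]
  {S : RandomSystem Ω X ℙ} {F : S.𝒳 → ℝ}

theorem Admissible.exists_regularData (hS : S.Admissible) (hF : Measurable F)
    (hFB : ∀ ω, ∃ f : S.B ω, f.val =ᵐ[S.m ω] csect F ω)
    (hFbdd : ∃ M : ℝ, ∀ᵐ ω ∂ℙ, ∀ f : S.B ω, f.val =ᵐ[S.m ω] csect F ω → ‖f‖ ≤ M) :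
    ∃ R : S.RegularData F, ∀ᵐ ω ∂ℙ, ω ∈ R.A := by
  obtain ⟨K, hK, hKb⟩ := hS.bounded
  obtain ⟨D, κ, hD, hκ, hdec⟩ := hS.decay
  obtain ⟨M, hM⟩ := hFbdd
  choose f hf using hFB
  obtain ⟨A, hA, hAi, hAe, hAp⟩ := exists_invariant_measurable_set S.σ S.ergodic.toMeasurePreserving
    (hKb.and (hdec.and hM))
  exact ⟨{ A := A
           K := K
           D := D
           r := Real.exp (-κ)
           -- `3 C |M|` bounds multiplication by `F`; the summand `1` makes `b` positive, and the
           -- absolute value is there because `M` carries no sign.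
           b := 3 * S.Cvar * |M| + 1
           f := f
           measurableSet_A := hA
           mem_iff := hAi
           pos_K := hK
           pos_D := hD
           pos_r := Real.exp_pos _
           r_lt_one := by simpa using hκ
           pos_b := by positivity
           measurable_F := hF
           bounded := fun ω hω => (hAp ω hω).1
           decay := fun ω hω n φ h1 h2 => by
             rw [← Real.exp_nat_mul, mul_comm (n : ℝ)]
             exact (hAp ω hω).2.1 n φ h1 h2
           f_ae_eq := hf
           norm_mul_f_le := fun ω hω => by
             refine (Variation.norm_mulCLM_le (f ω)).trans ?_
             have h1 : ‖f ω‖ ≤ |M| := ((hAp ω hω).2.2 (f ω) (hf ω)).trans (le_abs_self M)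
             have h2 := mul_le_mul_of_nonneg_left h1 (by positivity : 0 ≤ 3 * (S.Cvar : ℝ))
             linarith }, hAe⟩

namespace RegularData

variable (R : S.RegularData F)

variable {R} in
theorem exists_real_version {v : R.Fam} (hv : ∀ ω ∈ R.A, NonnegL1 (R.ev ω v).val) :
    ∃ v' : S.𝒳 → ℝ, Measurable v' ∧ (∀ p, 0 ≤ v' p) ∧
      ∀ ω ∈ R.A, (R.ev ω v).val =ᵐ[S.m ω] csect v' ω := by
  obtain ⟨g, hg, hg'⟩ := R.measurableVec_ev v
  refine ⟨fun p => max (g p).re 0, (Complex.measurable_re.comp hg).max measurable_const,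
    fun p => le_max_right _ _, fun ω hω => ?_⟩
  filter_upwards [hg' ω, hv ω hω] with x h1 h2
  rw [h1] at h2 ⊢
  refine Complex.ext ?_ ?_
  · exact (max_eq_left h2.2).symm
  · exact h2.1

variable [CompactSpace X] [BorelSpace X]

variable {R} in
theorem isEquivariantDensity (hA : ∀ᵐ ω ∂ℙ, ω ∈ R.A) {v : R.Fam} (hv : R.famOp v = v)
    (hv1 : ∀ ω ∈ R.A, (S.V ω).intCLM (R.ev ω v) = 1) {v' : S.𝒳 → ℝ} (hm : Measurable v')
    (h0 : ∀ p, 0 ≤ v' p) (h : ∀ ω ∈ R.A, (R.ev ω v).val =ᵐ[S.m ω] csect v' ω) :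
    S.IsEquivariantDensity v' where
  measurable := hm
  nonneg := h0
  integral_eq_one := hA.mono fun ω hω => by
    have h1 := hv1 ω hω
    rw [Variation.intCLM_apply, integral_congr_ae (h ω hω)] at h1
    have h2 : ((∫ x, sect v' ω x ∂(S.m ω) : ℝ) : ℂ) = 1 := by
      rw [← h1, ← integral_complex_ofReal]; rfl
    exact_mod_cast h2
  equivariant := hA.mono fun ω hω => by
    have h1 := R.ev_famOp v ω
    rw [hv] at h1
    have h2 := R.op_val hω (R.ev ω v)
    rw [← h1, transfer, transferL1_congr (h ω hω)] at h2
    rw [← h2]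
    exact h (S.σ ω) ((R.mem_iff ω).2 hω)

end RegularData

/-! ### Uniqueness of the equivariant density. -/

section Uniqueness

open Classical in
/-- The section `w(ω, ·)` as an element of `L¹`, when it is integrable. -/
def sectL1 (S : RandomSystem Ω X ℙ) (w : S.𝒳 → ℝ) (ω : Ω) : Lp ℂ 1 (S.m ω) :=
  if hi : Integrable (csect w ω) (S.m ω) then hi.toL1 _ else 0

/-- The pointwise conditions satisfied at almost every `ω` by an equivariant density. -/
structure DensityAt (S : RandomSystem Ω X ℙ) (w : S.𝒳 → ℝ) (ω : Ω) : Prop where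
  integral_eq_one : ∫ x, sect w ω x ∂(S.m ω) = 1
  equivariant : transferL1 (S.T ω) (S.m ω) (S.m (S.σ ω)) (csect w ω) =ᵐ[S.m (S.σ ω)]
    csect w (S.σ ω)

theorem DensityAt.sectL1_ae_eq {w : S.𝒳 → ℝ} {ω : Ω} (h : S.DensityAt w ω) :
    S.sectL1 w ω =ᵐ[S.m ω] csect w ω := by
  have hi : Integrable (csect w ω) (S.m ω) := by
    refine Integrable.ofReal (f := sect w ω) ?_
    -- A non-integrable function has Bochner integral `0`, so integral `1` already contains
    -- integrability.
    by_contra hi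
    have := h.integral_eq_one
    rw [integral_undef hi] at this
    exact zero_ne_one this
  rw [sectL1, dif_pos hi]
  exact hi.coeFn_toL1

theorem DensityAt.transfer_sectL1 {w : S.𝒳 → ℝ} {ω : Ω} (h : S.DensityAt w ω)
    (h' : S.DensityAt w (S.σ ω)) : S.transfer ω (S.sectL1 w ω) = S.sectL1 w (S.σ ω) := by
  rw [RandomSystem.transfer, transferL1_congr h.sectL1_ae_eq]
  exact Lp.ext (h.equivariant.trans h'.sectL1_ae_eq.symm)

theorem DensityAt.im_eq_zero {w : S.𝒳 → ℝ} {ω : Ω} (h : S.DensityAt w ω) :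
    ∀ᵐ x ∂(S.m ω), (S.sectL1 w ω x).im = 0 :=
  h.sectL1_ae_eq.mono fun x hx => by rw [hx]; simp [csect]

theorem DensityAt.nonnegL1 {w : S.𝒳 → ℝ} {ω : Ω} (h : S.DensityAt w ω) (h0 : ∀ p, 0 ≤ w p) :
    NonnegL1 (S.sectL1 w ω) :=
  h.sectL1_ae_eq.mono fun x hx => by
    rw [hx]
    exact ⟨Complex.ofReal_im _, h0 _⟩

theorem DensityAt.norm_eq_one {w : S.𝒳 → ℝ} {ω : Ω} (h : S.DensityAt w ω) (h0 : ∀ p, 0 ≤ w p) :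
    ‖S.sectL1 w ω‖ = 1 := by
  have h1 := (h.nonnegL1 h0).norm_eq
  have h2 : ∫ x, csect w ω x ∂(S.m ω) = 1 := by
    have h3 : ((∫ x, sect w ω x ∂(S.m ω) : ℝ) : ℂ) = 1 := by rw [h.integral_eq_one]; simp
    rw [← h3, ← integral_complex_ofReal]; rfl
  rw [integral_congr_ae h.sectL1_ae_eq, h2] at h1
  exact_mod_cast h1

theorem DensityAt.norm_sub_eq {w z : S.𝒳 → ℝ} {ω : Ω} (h : S.DensityAt w ω) (h' : S.DensityAt z ω) :
    ‖S.sectL1 w ω - S.sectL1 z ω‖ = ∫ x, sect (fun p => |w p - z p|) ω x ∂(S.m ω) := by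
  rw [L1.norm_eq_integral_norm]
  refine integral_congr_ae ?_
  filter_upwards [h.sectL1_ae_eq, h'.sectL1_ae_eq, Lp.coeFn_sub (S.sectL1 w ω) (S.sectL1 z ω)]
    with x h1 h2 h3
  rw [h3, Pi.sub_apply, h1, h2, csect, csect, ← Complex.ofReal_sub, Complex.norm_real]
  rfl

theorem norm_transfer_sub_le (ω : Ω) {f g : Lp ℂ 1 (S.m ω)} (hf : ∀ᵐ x ∂(S.m ω), (f x).im = 0)
    (hg : ∀ᵐ x ∂(S.m ω), (g x).im = 0) : ‖S.transfer ω f - S.transfer ω g‖ ≤ ‖f - g‖ := by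
  have h1 : S.transfer ω f - S.transfer ω g = S.transfer ω (f - g) := by
    rw [sub_eq_add_neg f g, ← neg_one_smul ℂ g, RandomSystem.transfer, RandomSystem.transfer,
      RandomSystem.transfer, transferL1_add (S.measurable_fiberMap ω) (S.nonsingular ω),
      transferL1_smul (S.measurable_fiberMap ω) (S.nonsingular ω), neg_one_smul, sub_eq_add_neg]
  rw [h1]
  refine (norm_transferL1_le (S.measurable_fiberMap ω) (S.nonsingular ω) ?_).1
  filter_upwards [hf, hg, Lp.coeFn_sub f g] with x h1 h2 h3
  rw [h3, Pi.sub_apply, Complex.sub_im, h1, h2, sub_zero]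

/-- Equivariance identifies the density at `σ^n ω` with the transported density at `ω`, and each
transfer contracts real `L¹` differences. -/
theorem norm_sectL1_sub_transferIter_le {w : S.𝒳 → ℝ} (n : ℕ) : ∀ (ω : Ω) (h : Lp ℂ 1 (S.m ω)),
    (∀ k, S.DensityAt w (S.σ^[k] ω)) → (∀ᵐ x ∂(S.m ω), (h x).im = 0) →
    ‖S.sectL1 w (S.σ^[n] ω) - S.transferIter n ω h‖ ≤ ‖S.sectL1 w ω - h‖ := by
  induction n with
  | zero => intro ω h _ _; exact le_rfl
  | succ n ih =>
    intro ω h hw hh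
    have hT := (norm_transferL1_le (S.measurable_fiberMap ω) (S.nonsingular ω) hh).2
    have h1 := ih (S.σ ω) (S.transfer ω h) (fun k => hw (k + 1)) hT
    refine h1.trans ?_
    have h0 : S.DensityAt w ω := hw 0
    rw [← h0.transfer_sectL1 (hw 1)]
    exact norm_transfer_sub_le ω h0.im_eq_zero hh

/-- A function on a probability space that does not increase along the orbits of a
measure-preserving transformation is almost surely invariant. -/
theorem ae_comp_eq_of_comp_le {ν : Measure Ω} [IsFiniteMeasure ν] {σ : Ω ≃ᵐ Ω}
    (hσ : MeasurePreserving σ ν ν) {d : Ω → ℝ} (hd : Integrable d ν)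
    (h : ∀ᵐ ω ∂ν, d (σ ω) ≤ d ω) : ∀ᵐ ω ∂ν, d (σ ω) = d ω := by
  have hd' : Integrable (fun ω => d (σ ω)) ν := (hσ.integrable_comp_emb σ.measurableEmbedding).2 hd
  have h1 : ∫ ω, (d ω - d (σ ω)) ∂ν = 0 := by
    rw [integral_sub hd hd', hσ.integral_comp σ.measurableEmbedding, sub_self]
  have h2 := (integral_eq_zero_iff_of_nonneg_ae (h.mono fun ω hω => sub_nonneg.2 hω)
    (hd.sub hd')).1 h1
  exact h2.mono fun ω hω => (sub_eq_zero.1 hω).symm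

variable [CompactSpace X] [BorelSpace X]

theorem RegularData.ae_eq_of_isEquivariantDensity [IsProbabilityMeasure ℙ] {R : S.RegularData F}
    (hA : ∀ᵐ ω ∂ℙ, ω ∈ R.A) {v : R.Fam} (hv : R.famOp v = v)
    (hv1 : ∀ ω ∈ R.A, (S.V ω).intCLM (R.ev ω v) = 1) {v' : S.𝒳 → ℝ}
    (h : ∀ ω ∈ R.A, (R.ev ω v).val =ᵐ[S.m ω] csect v' ω) (hv' : S.IsEquivariantDensity v')
    {w : S.𝒳 → ℝ} (hw : S.IsEquivariantDensity w) :
    ∀ᵐ ω ∂ℙ, sect w ω =ᵐ[S.m ω] sect v' ω := by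
  have hσ := S.ergodic.toMeasurePreserving
  set d : Ω → ℝ := fun ω => ∫ x, sect (fun p => |w p - v' p|) ω x ∂(S.m ω) with hd
  have hP : ∀ᵐ ω ∂ℙ, ω ∈ R.A ∧ S.DensityAt w ω ∧ S.DensityAt v' ω := by
    filter_upwards [hA, hw.integral_eq_one, hw.equivariant, hv'.integral_eq_one, hv'.equivariant]
      with ω h1 h2 h3 h4 h5
    exact ⟨h1, ⟨h2, h3⟩, ⟨h4, h5⟩⟩
  have hPn : ∀ᵐ ω ∂ℙ, ∀ n : ℕ, S.σ^[n] ω ∈ R.A ∧ S.DensityAt w (S.σ^[n] ω) ∧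
      S.DensityAt v' (S.σ^[n] ω) :=
    ae_all_iff.2 fun n => (hσ.iterate n).quasiMeasurePreserving.ae hP
  have hdm : Measurable d := S.measurable_m _ (hw.measurable.sub hv'.measurable).norm
  have hdi : Integrable d ℙ := by
    refine Integrable.of_bound hdm.aestronglyMeasurable 2 (hP.mono fun ω hω => ?_)
    rw [hd]
    dsimp only
    rw [← hω.2.1.norm_sub_eq hω.2.2, Real.norm_of_nonneg (norm_nonneg _)]
    refine (norm_sub_le _ _).trans ?_
    rw [hω.2.1.norm_eq_one hw.nonneg, hω.2.2.norm_eq_one hv'.nonneg]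
    norm_num
  -- Contraction gives `d ∘ σ ≤ d`; as `d` is integrable and `σ` preserves `ℙ`, equality holds
  -- almost surely.
  have hinv : ∀ᵐ ω ∂ℙ, d (S.σ ω) = d ω := by
    refine ae_comp_eq_of_comp_le hσ hdi (hPn.mono fun ω hω => ?_)
    have h0 : ω ∈ R.A ∧ S.DensityAt w ω ∧ S.DensityAt v' ω := hω 0
    have h1 : S.σ ω ∈ R.A ∧ S.DensityAt w (S.σ ω) ∧ S.DensityAt v' (S.σ ω) := hω 1
    have e1 : d (S.σ ω) = _ := (h1.2.1.norm_sub_eq h1.2.2).symm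
    have e0 : d ω = _ := (h0.2.1.norm_sub_eq h0.2.2).symm
    rw [e1, e0]
    have := norm_transfer_sub_le ω h0.2.1.im_eq_zero h0.2.2.im_eq_zero
    rw [h0.2.1.transfer_sectL1 h1.2.1, h0.2.2.transfer_sectL1 h1.2.2] at this
    exact this
  have hinvn : ∀ᵐ ω ∂ℙ, ∀ n : ℕ, d (S.σ (S.σ^[n] ω)) = d (S.σ^[n] ω) :=
    ae_all_iff.2 fun n => (hσ.iterate n).quasiMeasurePreserving.ae hinv
  filter_upwards [hPn, hinvn] with ω hω hdn
  have hdω : ∀ n, d (S.σ^[n] ω) = d ω := fun n => by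
    induction n with
    | zero => rfl
    | succ n ih => rw [Function.iterate_succ_apply', hdn, ih]
  have hωA : ω ∈ R.A := (hω 0).1
  have hwω : S.DensityAt w ω := (hω 0).2.1
  have hvω : S.DensityAt v' ω := (hω 0).2.2
  have hvval : ∀ n, S.sectL1 v' (S.σ^[n] ω) = (R.ev (S.σ^[n] ω) v).val := fun n =>
    Lp.ext ((hω n).2.2.sectL1_ae_eq.trans (h _ (hω n).1).symm)
  have hpow : ∀ n : ℕ, (R.famOp ^ n) v = v := fun n => by
    induction n with
    | zero => rfl
    | succ n ih => rw [pow_succ]; exact (congrArg (R.famOp ^ n) hv).trans ih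
  have hle : ∀ ε > 0, d ω ≤ ε := fun ε hε => by
    -- By (V6) a density `k ∈ 𝓑_ω` lies within `ε` of `w_ω`. Comparing through `L^(n) k` gives `d ω
    -- = d (σ^n ω) ≤ ε + D r^n ‖k - v_ω‖`, since `k - v_ω` has zero integral; then `n → ∞`.
    obtain ⟨k, ⟨hk0, hk1, hkv⟩, hkd⟩ := Metric.mem_closure_iff.1
      ((S.V ω).dense ⟨hwω.nonnegL1 hw.nonneg, hwω.norm_eq_one hw.nonneg⟩) ε hε
    set kB : S.B ω := Variation.Space.mk k hkv with hkB
    have hint : (S.V ω).intCLM (kB - R.ev ω v) = 0 := by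
      rw [map_sub, hv1 ω hωA, Variation.intCLM_apply, hkB, Variation.Space.val_mk, ← hk0.norm_eq,
        hk1]
      simp
    have hbound : ∀ n : ℕ, d ω ≤ ε + R.D * R.r ^ n * ‖kB - R.ev ω v‖ := fun n => by
      have e1 : d (S.σ^[n] ω) = _ := ((hω n).2.1.norm_sub_eq (hω n).2.2).symm
      have hpow := hpow n
      have e3 := R.iter_op_val n ω hωA kB
      have e4 := (Variation.Space.norm_val_le _).trans (R.norm_iter_op_le hωA _ hint n)
      rw [map_sub, Variation.Space.val_sub, e3, ← R.ev_famOp_pow, hpow, ← hvval n] at e4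
      have e5 := norm_sectL1_sub_transferIter_le n ω k (fun k => (hω k).2.1)
        (hk0.mono fun x hx => hx.1)
      rw [← hdω n, e1]
      refine (norm_sub_le_norm_sub_add_norm_sub _ (S.transferIter n ω k) _).trans
        (add_le_add (e5.trans ?_) e4)
      rw [← dist_eq_norm]
      exact hkd.le
    have ht : Tendsto (fun n : ℕ => ε + R.D * R.r ^ n * ‖kB - R.ev ω v‖) atTop (𝓝 ε) := by
      simpa using (((tendsto_pow_atTop_nhds_zero_of_lt_one R.pos_r.le R.r_lt_one).const_mul
        R.D).mul_const ‖kB - R.ev ω v‖).const_add ε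
    exact ge_of_tendsto' ht hbound
  have hd0 : ‖S.sectL1 w ω - S.sectL1 v' ω‖ ≤ 0 := by
    rw [hwω.norm_sub_eq hvω]
    exact le_of_forall_pos_le_add fun ε hε => by simpa using hle ε hε
  have heq : S.sectL1 w ω = S.sectL1 v' ω := by
    rw [← sub_eq_zero, ← norm_le_zero_iff]; exact hd0
  have hfin := hwω.sectL1_ae_eq.symm.trans (heq ▸ hvω.sectL1_ae_eq)
  exact hfin.mono fun x hx => Complex.ofReal_injective hx

end Uniqueness

end RandomSystem

end

/-! ### Assembly of the theorem. -/

theorem mainTheorem8 {Ω X : Type*} [MeasurableSpace Ω] (ℙ : Measure Ω) [IsProbabilityMeasure ℙ]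
    [MetricSpace X] [CompactSpace X] [MeasurableSpace X] [BorelSpace X]
    (S : RandomSystem Ω X ℙ) (hS : S.Admissible)
    (F : S.𝒳 → ℝ) (hF : Measurable F)
    (hFB : ∀ ω, ∃ f : S.B ω, f.val =ᵐ[S.m ω] csect F ω)
    (hFbdd : ∃ M : ℝ, ∀ᵐ ω ∂ℙ, ∀ f : S.B ω, f.val =ᵐ[S.m ω] csect F ω → ‖f‖ ≤ M) :
    -- the essentially unique equivariant density `v`
    ∃ v : S.𝒳 → ℝ, S.IsEquivariantDensity v ∧
      (∀ w : S.𝒳 → ℝ, S.IsEquivariantDensity w → ∀ᵐ ω ∂ℙ, sect w ω =ᵐ[S.m ω] sect v ω) ∧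
    -- the twisted operators are well-defined bounded operators `𝓑_ω → 𝓑_{σω}`
    ∃ L : ℂ → ∀ ω, S.B ω →L[ℂ] S.B (S.σ ω),
      (∀ᵐ ω ∂ℙ, ∀ θ : ℂ, S.IsTwisted F θ ω (L θ ω)) ∧
    ∃ U : Set ℂ, IsOpen U ∧ 0 ∈ U ∧
    ∃ (l : ℂ → Ω → ℂ) (u : ℂ → ∀ ω, S.B ω) (φ : ℂ → ∀ ω, S.B ω →L[ℂ] ℂ),
      -- (1) eigenvectors, dual eigenfunctionals, normalization
      (∀ᵐ ω ∂ℙ, ∀ θ ∈ U,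
        L θ ω (u θ ω) = l θ ω • u θ (S.σ ω) ∧
        (φ θ (S.σ ω)).comp (L θ ω) = l θ ω • φ θ ω ∧
        φ θ ω (u θ ω) = 1) ∧
      -- (2) the triplet at `θ = 0`
      (∀ᵐ ω ∂ℙ, l 0 ω = 1 ∧ (u 0 ω).val =ᵐ[S.m ω] csect v ω ∧
        ∀ h : S.B ω, φ 0 ω h = ∫ x, h.val x ∂(S.m ω)) ∧
      -- (3) analyticity
      (∀ᵐ ω ∂ℙ, AnalyticOnNhd ℂ (fun θ => l θ ω) U ∧
        AnalyticOnNhd ℂ (fun θ => u θ ω) U ∧ AnalyticOnNhd ℂ (fun θ => φ θ ω) U) ∧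
      -- (4) measurability
      (∀ θ ∈ U, Measurable (l θ) ∧ S.MeasurableVec (u θ) ∧ S.MeasurableDual (φ θ)) ∧
      -- (5) uniform bounds
      (∃ C : ℝ, 0 < C ∧ ∀ᵐ ω ∂ℙ, ∀ θ ∈ U, ‖l θ ω‖ ≤ C ∧ ‖u θ ω‖ ≤ C ∧ ‖φ θ ω‖ ≤ C) ∧
      -- (6) exponential spectral gap
      (∃ c r : ℝ, 0 < c ∧ 0 < r ∧ r < 1 ∧ ∀ᵐ ω ∂ℙ, ∀ n : ℕ, ∀ h : S.B ω, ∀ θ ∈ U,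
        ‖S.iterOp (L θ) n ω h -
            ((∏ i ∈ Finset.range n, l θ (S.σ^[i] ω)) * φ θ ω h) • u θ (S.σ^[n] ω)‖
          ≤ c * r ^ n * ‖h‖) := by
  obtain ⟨R, hA⟩ := hS.exists_regularData hF hFB hFbdd
  obtain ⟨v, hv, hv1, hv0⟩ := R.exists_invariant_family
  obtain ⟨v', hm, h0, hvv'⟩ := RandomSystem.RegularData.exists_real_version hv0
  have hdens := RandomSystem.RegularData.isEquivariantDensity hA hv hv1 hm h0 hvv'
  obtain ⟨u, U, δ, C, H⟩ := R.exists_eigenfamily hv hv1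
  have hcases : ∀ {a : ℝ}, (∀ ω ∈ R.A, ∀ θ ∈ U, ‖R.eigenfunctional u θ ω‖ ≤ a) →
      ∃ C : ℝ, 0 < C ∧ ∀ᵐ ω ∂ℙ, ∀ θ ∈ U, ‖R.eigenvalue u θ ω‖ ≤ C ∧ ‖R.ev ω (u θ)‖ ≤ C ∧
        ‖R.eigenfunctional u θ ω‖ ≤ C := fun {a} ha => by
    refine ⟨max (1 + δ) (max C a), lt_max_of_lt_left (by linarith [H.pos_δ]), ?_⟩
    filter_upwards [hA] with ω hω θ hθ
    exact ⟨(H.norm_eigenvalue_le hθ hω).trans (le_max_left _ _),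
      ((R.norm_ev_le _ _).trans (H.norm_le θ hθ)).trans
        ((le_max_left _ _).trans (le_max_right _ _)),
      (ha ω hω θ hθ).trans ((le_max_right _ _).trans (le_max_right _ _))⟩
  refine ⟨v', hdens, fun w hw => RandomSystem.RegularData.ae_eq_of_isEquivariantDensity hA hv hv1
    hvv' hdens hw, R.twisted, hA.mono fun ω hω θ => R.isTwisted θ hω, U, H.isOpen, H.zero_mem,
    R.eigenvalue u, fun θ ω => R.ev ω (u θ), R.eigenfunctional u, ?_, ?_, ?_, ?_, ?_, ?_⟩
  · filter_upwards [hA] with ω hω θ hθ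
    exact ⟨H.twisted_apply hθ ω, H.eigenfunctional_comp hθ hω, H.eigenfunctional_eigenvector hθ hω⟩
  · filter_upwards [hA] with ω hω
    refine ⟨H.eigenvalue_zero hω, ?_, fun h => ?_⟩
    · rw [H.at_zero]; exact hvv' ω hω
    · rw [H.eigenfunctional_zero hω]; rfl
  · filter_upwards [hA] with ω hω
    exact ⟨(H.differentiableOn_eigenvalue ω).analyticOnNhd H.isOpen,
      (H.differentiableOn_eigenvector ω).analyticOnNhd H.isOpen,
      (H.differentiableOn_eigenfunctional hω).analyticOnNhd H.isOpen⟩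
  · exact fun θ hθ => ⟨R.measurable_eigenvalue u θ, R.measurableVec_ev (u θ), H.measurableDual hθ⟩
  · exact hcases fun ω hω θ hθ => H.norm_eigenfunctional_le hθ hω
  · obtain ⟨c, r, hc, hr0, hr1, hgap⟩ := H.norm_iterOp_sub_le
    exact ⟨c, r, hc, hr0, hr1, hA.mono hgap⟩
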